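/- **Conventions.** A complex Banach lattice $E$ is the complexification $E = E_{\mathbb R} + iE_{\mathbb R}$ of a real Banach lattice $E_{\mathbb R}$, with modulus $|x+iy| = \sup_{\theta\in\mathbb R}(\cos\theta\, x + \sin\theta\, y)$ and norm $\|z\| = \|\,|z|\,\|$; $z \ge 0$ means $z \in E_{\mathbb R}$ and $z \ge 0$ there. A bounded linear operator $T$ on $E$ is positive if $Tz \ge 0$ whenever $z \ge 0$; $r(T)$ is its spectral radius. $E$ has a pre-dual Banach lattice $F$ if $F$ is a complex Banach lattice whose dual $F'$ (with the dual norm, and ordered by the positive functionals) is $E$, up to an isometric linear order isomorphism; $T$ has a pre-adjoint if there is a bounded linear operator $S$ on $F$ with $S' = T$. A function on $\overline{\mathbb D} = \{z\in\mathbb C : |z|\le 1\}$ is analytic if it extends analytically to an open neighbourhood of $\overline{\mathbb D}$. A weighting scheme is a net $(f_j)_{j\in J}$ (over a non-empty directed set $J$) of analytic functions on $\overline{\mathbb D}$ such that $f_j(1)=1$ and $f_j^{(k)}(0)\ge 0$ for all $j\in J$ and all integers $k\ge 0$, and $f_j(z)\to 0$ for every $z\in\mathbb C$ with $|z|<1$.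 If $r(T)=1$ and $f(z)=\sum_{k\ge0}a_kz^k$ is analytic on $\overline{\mathbb D}$, put $f(T)=\sum_{k\ge 0}a_kT^k$. The operator $T$, $r(T)=1$, is (WS)-bounded if there is a weighting scheme $(f_j)_{j\in J}$ with $\sup_{j\in J}\|f_j(T)\|<\infty$. The dimension of a vector space is a non-negative integer or $\infty$ (infinite cardinalities are not distinguished). The peripheral point spectrum of $T$ is the set of eigenvalues $\lambda$ of $T$ with $|\lambda|=r(T)$. A set $M\subset\mathbb C$ is cyclic if $re^{i\theta}\in M$ ($r\ge0$, $\theta\in\mathbb R$) implies $re^{in\theta}\in M$ for every $n\in\mathbb Z$. **Theorem.** Let $T$ be a positive bounded linear operator on a complex Banach lattice $E$ with $r(T)=1$. Suppose that $E$ has a pre-dual Banach lattice $F$ and that $T$ has a pre-adjoint on $F$. If $T$ is (WS)-bounded, then $$\dim\ker(e^{i\theta}-T)\;\le\;\dim\ker(e^{in\theta}-T)\qquad\text{for all } n\in\mathbb Z \text{ and } \theta\in\mathbb R.$$ In particular, the peripheral point spectrum of $T$ is cyclic. -/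

import Mathlib

universe u v w

/-! ## Complex Banach lattices

A real Banach lattice is a real Banach space `X` with a lattice order that is compatible with the
vector space structure and for which the norm is solid, i.e. a type with the instances
`[NormedAddCommGroup X] [NormedSpace ℝ X] [CompleteSpace X] [Lattice X] [IsOrderedAddMonoid X]
[IsOrderedModule ℝ X] [HasSolidNorm X]`.
A complex Banach lattice is the complexification of a real Banach lattice, with
the modulus `|x + iy| = sup_θ (cos θ x + sin θ y)` and the norm `‖z‖ = ‖ |z| ‖`. -/

/-- The complexification `X + iX` of a real vector space `X`. -/
@[ext]
structure Complexification (X : Type u) where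
  /-- the real part -/
  re : X
  /-- the imaginary part -/
  im : X

namespace Complexification

section Algebra

variable {X : Type u} [AddCommGroup X]

instance : Zero (Complexification X) := ⟨⟨0, 0⟩⟩
instance : Add (Complexification X) := ⟨fun z w => ⟨z.re + w.re, z.im + w.im⟩⟩
instance : Neg (Complexification X) := ⟨fun z => ⟨-z.re, -z.im⟩⟩
instance : Sub (Complexification X) := ⟨fun z w => ⟨z.re - w.re, z.im - w.im⟩⟩

@[simp] theorem zero_re : (0 : Complexification X).re = 0 := rfl
@[simp] theorem zero_im : (0 : Complexification X).im = 0 := rfl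
@[simp] theorem add_re (z w : Complexification X) : (z + w).re = z.re + w.re := rfl
@[simp] theorem add_im (z w : Complexification X) : (z + w).im = z.im + w.im := rfl
@[simp] theorem neg_re (z : Complexification X) : (-z).re = -z.re := rfl
@[simp] theorem neg_im (z : Complexification X) : (-z).im = -z.im := rfl
@[simp] theorem sub_re (z w : Complexification X) : (z - w).re = z.re - w.re := rfl
@[simp] theorem sub_im (z w : Complexification X) : (z - w).im = z.im - w.im := rfl

instance : AddCommGroup (Complexification X) where
  add_assoc a b c := by ext <;> simp [add_assoc]
  zero_add a := by ext <;> simp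
  add_zero a := by ext <;> simp
  nsmul := nsmulRec
  zsmul := zsmulRec
  neg_add_cancel a := by ext <;> simp
  add_comm a b := by ext <;> simp [add_comm]
  sub_eq_add_neg a b := by ext <;> simp [sub_eq_add_neg]

variable [Module ℝ X]

instance : SMul ℂ (Complexification X) :=
  ⟨fun c z => ⟨c.re • z.re - c.im • z.im, c.re • z.im + c.im • z.re⟩⟩

@[simp] theorem smul_re (c : ℂ) (z : Complexification X) :
    (c • z).re = c.re • z.re - c.im • z.im := rfl
@[simp] theorem smul_im (c : ℂ) (z : Complexification X) :
    (c • z).im = c.re • z.im + c.im • z.re := rfl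

instance : Module ℂ (Complexification X) where
  one_smul z := by ext <;> simp
  mul_smul a b z := by
    ext <;> simp only [smul_re, smul_im, Complex.mul_re, Complex.mul_im] <;> module
  smul_zero a := by ext <;> simp
  smul_add a z w := by
    ext <;> simp only [smul_re, smul_im, add_re, add_im] <;> module
  add_smul a b z := by
    ext <;> simp only [smul_re, smul_im, add_re, add_im, Complex.add_re, Complex.add_im] <;> module
  zero_smul z := by ext <;> simp

end Algebra

section Lattice

variable {X : Type u} [NormedAddCommGroup X] [NormedSpace ℝ X]

/-- The real vector `Re (exp (-iθ) z) = cos θ x + sin θ y` for `z = x + iy`. -/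
noncomputable def rot (z : Complexification X) (θ : ℝ) : X :=
  Real.cos θ • z.re + Real.sin θ • z.im

variable [Lattice X] [IsOrderedAddMonoid X] [IsOrderedModule ℝ X]

theorem smul_le_abs_smul_abs (c : ℝ) (x : X) : c • x ≤ |c| • |x| := by
  rcases le_total 0 c with h | h
  · rw [abs_of_nonneg h]
    exact smul_le_smul_of_nonneg_left (le_abs_self x) h
  · rw [abs_of_nonpos h]
    have : c • x = (-c) • (-x) := by simp
    rw [this]
    exact smul_le_smul_of_nonneg_left (neg_le_abs x) (neg_nonneg.mpr h)

theorem rot_le_rot_add (z : Complexification X) (a b : ℝ) :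
    rot z a ≤ rot z b + |a - b| • (|z.re| + |z.im|) := by
  have hc : |Real.cos a - Real.cos b| ≤ |a - b| := by
    simpa [Real.dist_eq] using Real.lipschitzWith_cos.dist_le_mul a b
  have hs : |Real.sin a - Real.sin b| ≤ |a - b| := by
    simpa [Real.dist_eq] using Real.lipschitzWith_sin.dist_le_mul a b
  have h1 : (Real.cos a - Real.cos b) • z.re ≤ |a - b| • |z.re| :=
    (smul_le_abs_smul_abs _ _).trans (smul_le_smul_of_nonneg_right hc (abs_nonneg _))
  have h2 : (Real.sin a - Real.sin b) • z.im ≤ |a - b| • |z.im| :=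
    (smul_le_abs_smul_abs _ _).trans (smul_le_smul_of_nonneg_right hs (abs_nonneg _))
  have e : rot z a = rot z b +
      ((Real.cos a - Real.cos b) • z.re + (Real.sin a - Real.sin b) • z.im) := by
    unfold rot
    module
  rw [e, smul_add]
  gcongr

/-- Finite approximation of the modulus. -/
noncomputable def approx (z : Complexification X) (n : ℕ) : X :=
  (Finset.range (2 ^ n)).sup' (Finset.nonempty_range_iff.mpr (by positivity))
    (fun k => rot z (2 * Real.pi * k / 2 ^ n))

theorem rot_le_approx_add (z : Complexification X) (n : ℕ) (θ : ℝ) :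
    rot z θ ≤ approx z n + (2 * Real.pi / 2 ^ n) • (|z.re| + |z.im|) := by
  have hpi := Real.pi_pos
  set m : ℤ := ⌊θ * 2 ^ n / (2 * Real.pi)⌋ with hm
  set k : ℕ := (m % 2 ^ n).toNat with hk
  have hpos : (0 : ℤ) < 2 ^ n := by positivity
  have hk0 : 0 ≤ m % 2 ^ n := Int.emod_nonneg _ hpos.ne'
  have hkc : (k : ℤ) = m % 2 ^ n := Int.toNat_of_nonneg hk0
  have hklt : k < 2 ^ n := by
    have := Int.emod_lt_of_pos m hpos
    rw [← hkc] at this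
    exact_mod_cast this
  have hmk : (m : ℝ) = 2 ^ n * (m / 2 ^ n : ℤ) + k := by
    have h := Int.mul_ediv_add_emod m (2 ^ n)
    rw [← hkc] at h
    exact_mod_cast h.symm
  set θ' : ℝ := θ - (m / 2 ^ n : ℤ) * (2 * Real.pi) with hθ'
  have hrot : rot z θ = rot z θ' := by
    simp only [rot, hθ', Real.cos_sub_int_mul_two_pi, Real.sin_sub_int_mul_two_pi]
  have hdiff : θ' - 2 * Real.pi * k / 2 ^ n
      = (2 * Real.pi / 2 ^ n) * (θ * 2 ^ n / (2 * Real.pi) - m) := by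
    rw [hmk, hθ']
    field_simp
    ring
  have hb : |θ' - 2 * Real.pi * k / 2 ^ n| ≤ 2 * Real.pi / 2 ^ n := by
    have h0 : 0 ≤ θ * 2 ^ n / (2 * Real.pi) - m := sub_nonneg.mpr (Int.floor_le _)
    have h1 : θ * 2 ^ n / (2 * Real.pi) - m ≤ 1 := by
      have := Int.lt_floor_add_one (θ * 2 ^ n / (2 * Real.pi))
      rw [← hm] at this
      linarith
    rw [hdiff, abs_mul, abs_of_nonneg h0, abs_of_nonneg (by positivity)]
    exact mul_le_of_le_one_right (by positivity) h1
  rw [hrot]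
  refine (rot_le_rot_add z θ' (2 * Real.pi * k / 2 ^ n)).trans (add_le_add ?_ ?_)
  · exact Finset.le_sup' (fun k : ℕ => rot z (2 * Real.pi * k / 2 ^ n))
      (Finset.mem_range.mpr hklt)
  · exact smul_le_smul_of_nonneg_right hb (add_nonneg (abs_nonneg _) (abs_nonneg _))

variable [HasSolidNorm X] [CompleteSpace X]

/-- In a Banach lattice the supremum `sup_θ (cos θ x + sin θ y)` exists. -/
theorem exists_modulus (z : Complexification X) : ∃ m : X, IsLUB (Set.range (rot z)) m := by
  have hpi := Real.pi_pos
  set t : X := |z.re| + |z.im| with ht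
  have ht0 : 0 ≤ t := add_nonneg (abs_nonneg _) (abs_nonneg _)
  have step : ∀ n k : ℕ, approx z k ≤ approx z n + (2 * Real.pi / 2 ^ n) • t := fun n k =>
    Finset.sup'_le _ _ fun i _ => rot_le_approx_add z n _
  have hdist : ∀ n, dist (approx z n) (approx z (n + 1)) ≤ (4 * Real.pi * ‖t‖) / 2 / 2 ^ n := by
    intro n
    have hle : |approx z n - approx z (n + 1)| ≤ |(2 * Real.pi / 2 ^ n) • t| := by
      have hnn : (0 : X) ≤ (2 * Real.pi / 2 ^ n) • t := smul_nonneg (by positivity) ht0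
      rw [abs_of_nonneg hnn, abs_le']
      constructor
      · rw [sub_le_iff_le_add']
        refine (step (n + 1) n).trans (add_le_add_right ?_ _)
        refine smul_le_smul_of_nonneg_right ?_ ht0
        gcongr
        · norm_num
        · omega
      · rw [neg_sub, sub_le_iff_le_add']
        exact step n (n + 1)
    calc dist (approx z n) (approx z (n + 1)) = ‖approx z n - approx z (n + 1)‖ := dist_eq_norm _ _
      _ ≤ ‖(2 * Real.pi / 2 ^ n) • t‖ := norm_le_norm_of_abs_le_abs hle
      _ = (4 * Real.pi * ‖t‖) / 2 / 2 ^ n := by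
          rw [norm_smul, Real.norm_of_nonneg (by positivity)]
          ring
  obtain ⟨L, hL⟩ := cauchySeq_tendsto_of_complete (cauchySeq_of_le_geometric_two hdist)
  refine ⟨L, ?_, ?_⟩
  · rintro _ ⟨θ, rfl⟩
    have h0 : Filter.Tendsto (fun n : ℕ => 2 * Real.pi / 2 ^ n) Filter.atTop (nhds 0) :=
      tendsto_const_nhds.div_atTop (tendsto_pow_atTop_atTop_of_one_lt one_lt_two)
    have h1 := hL.add (h0.smul_const t)
    rw [zero_smul, add_zero] at h1
    exact ge_of_tendsto' h1 fun n => rot_le_approx_add z n θ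
  · intro b hb
    exact le_of_tendsto' hL fun n => Finset.sup'_le _ _ fun i _ => hb ⟨_, rfl⟩

/-- The modulus `|z| = sup_θ (cos θ x + sin θ y)` of `z = x + iy`. -/
noncomputable def modulus (z : Complexification X) : X := (exists_modulus z).choose

theorem isLUB_modulus (z : Complexification X) : IsLUB (Set.range (rot z)) (modulus z) :=
  (exists_modulus z).choose_spec

theorem rot_le_modulus (z : Complexification X) (θ : ℝ) : rot z θ ≤ modulus z :=
  (isLUB_modulus z).1 ⟨θ, rfl⟩

theorem modulus_le {z : Complexification X} {b : X} (h : ∀ θ, rot z θ ≤ b) : modulus z ≤ b :=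
  (isLUB_modulus z).2 (by rintro _ ⟨θ, rfl⟩; exact h θ)

theorem abs_re_le_modulus (z : Complexification X) : |z.re| ≤ modulus z :=
  abs_le'.mpr ⟨by simpa [rot] using rot_le_modulus z 0,
    by simpa [rot] using rot_le_modulus z Real.pi⟩

theorem abs_im_le_modulus (z : Complexification X) : |z.im| ≤ modulus z :=
  abs_le'.mpr ⟨by simpa [rot] using rot_le_modulus z (Real.pi / 2),
    by simpa [rot] using rot_le_modulus z (-(Real.pi / 2))⟩

theorem modulus_nonneg (z : Complexification X) : 0 ≤ modulus z :=
  (abs_nonneg _).trans (abs_re_le_modulus z)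

theorem modulus_le_abs_add_abs (z : Complexification X) : modulus z ≤ |z.re| + |z.im| := by
  refine modulus_le fun θ => add_le_add ?_ ?_
  · refine (smul_le_abs_smul_abs _ _).trans ?_
    simpa using smul_le_smul_of_nonneg_right (Real.abs_cos_le_one θ) (abs_nonneg z.re)
  · refine (smul_le_abs_smul_abs _ _).trans ?_
    simpa using smul_le_smul_of_nonneg_right (Real.abs_sin_le_one θ) (abs_nonneg z.im)

theorem modulus_add_le (z w : Complexification X) : modulus (z + w) ≤ modulus z + modulus w := by
  refine modulus_le fun θ => ?_
  have e : rot (z + w) θ = rot z θ + rot w θ := by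
    simp only [rot, add_re, add_im]
    module
  rw [e]
  exact add_le_add (rot_le_modulus z θ) (rot_le_modulus w θ)

theorem modulus_smul_le (c : ℂ) (z : Complexification X) :
    modulus (c • z) ≤ ‖c‖ • modulus z := by
  refine modulus_le fun θ => ?_
  have h1 : c.re = ‖c‖ * Real.cos c.arg := (Complex.norm_mul_cos_arg c).symm
  have h2 : c.im = ‖c‖ * Real.sin c.arg := (Complex.norm_mul_sin_arg c).symm
  have e : rot (c • z) θ = ‖c‖ • rot z (θ - c.arg) := by
    simp only [rot, smul_re, smul_im, Real.cos_sub, Real.sin_sub]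
    rw [h1, h2]
    module
  rw [e]
  exact smul_le_smul_of_nonneg_left (rot_le_modulus z _) (norm_nonneg c)

noncomputable instance : Norm (Complexification X) := ⟨fun z => ‖modulus z‖⟩

theorem norm_def (z : Complexification X) : ‖z‖ = ‖modulus z‖ := rfl

theorem norm_le_norm_of_nonneg_of_le {a b : X} (ha : 0 ≤ a) (hab : a ≤ b) : ‖a‖ ≤ ‖b‖ :=
  norm_le_norm_of_abs_le_abs (by rwa [abs_of_nonneg ha, abs_of_nonneg (ha.trans hab)])

theorem norm_re_le (z : Complexification X) : ‖z.re‖ ≤ ‖z‖ := by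
  rw [norm_def, ← norm_abs_eq_norm z.re]
  exact norm_le_norm_of_nonneg_of_le (abs_nonneg _) (abs_re_le_modulus z)

theorem norm_im_le (z : Complexification X) : ‖z.im‖ ≤ ‖z‖ := by
  rw [norm_def, ← norm_abs_eq_norm z.im]
  exact norm_le_norm_of_nonneg_of_le (abs_nonneg _) (abs_im_le_modulus z)

theorem norm_le_re_add_im (z : Complexification X) : ‖z‖ ≤ ‖z.re‖ + ‖z.im‖ := by
  rw [norm_def, ← norm_abs_eq_norm z.re, ← norm_abs_eq_norm z.im]
  exact (norm_le_norm_of_nonneg_of_le (modulus_nonneg z) (modulus_le_abs_add_abs z)).trans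
    (norm_add_le _ _)

theorem norm_smul_le_aux (c : ℂ) (z : Complexification X) : ‖c • z‖ ≤ ‖c‖ * ‖z‖ := by
  rw [norm_def, norm_def]
  refine (norm_le_norm_of_nonneg_of_le (modulus_nonneg _) (modulus_smul_le c z)).trans ?_
  rw [norm_smul, norm_norm]

theorem normCore : NormedSpace.Core ℂ (Complexification X) where
  norm_nonneg _ := norm_nonneg (_ : X)
  norm_smul c z := by
    refine le_antisymm (norm_smul_le_aux c z) ?_
    rcases eq_or_ne c 0 with rfl | hc
    · rw [norm_zero, zero_mul]
      exact norm_nonneg (_ : X)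
    · have h := norm_smul_le_aux c⁻¹ (c • z)
      rw [inv_smul_smul₀ hc, norm_inv] at h
      have hc' : 0 < ‖c‖ := norm_pos_iff.mpr hc
      calc ‖c‖ * ‖z‖ ≤ ‖c‖ * (‖c‖⁻¹ * ‖c • z‖) := by gcongr
        _ = ‖c • z‖ := by field_simp
  norm_triangle z w :=
    (norm_le_norm_of_nonneg_of_le (modulus_nonneg _) (modulus_add_le z w)).trans (norm_add_le _ _)
  norm_eq_zero_iff z := by
    constructor
    · intro h
      have hr := norm_re_le z
      have hi := norm_im_le z
      rw [h] at hr hi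
      exact Complexification.ext (norm_le_zero_iff.mp hr) (norm_le_zero_iff.mp hi)
    · rintro rfl
      refine le_antisymm ?_ (norm_nonneg (_ : X))
      simpa using norm_le_re_add_im (0 : Complexification X)

noncomputable instance : NormedAddCommGroup (Complexification X) :=
  NormedAddCommGroup.ofCore (normCore (X := X))

noncomputable instance : NormedSpace ℂ (Complexification X) :=
  NormedSpace.ofCore (normCore (X := X))

instance : CompleteSpace (Complexification X) := by
  refine Metric.complete_of_cauchySeq_tendsto fun s hs => ?_
  have hre : CauchySeq fun n => (s n).re := by
    rw [Metric.cauchySeq_iff'] at hs ⊢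
    intro ε hε
    obtain ⟨N, hN⟩ := hs ε hε
    refine ⟨N, fun n hn => lt_of_le_of_lt ?_ (hN n hn)⟩
    rw [dist_eq_norm, dist_eq_norm]
    exact norm_re_le (s n - s N)
  have him : CauchySeq fun n => (s n).im := by
    rw [Metric.cauchySeq_iff'] at hs ⊢
    intro ε hε
    obtain ⟨N, hN⟩ := hs ε hε
    refine ⟨N, fun n hn => lt_of_le_of_lt ?_ (hN n hn)⟩
    rw [dist_eq_norm, dist_eq_norm]
    exact norm_im_le (s n - s N)
  obtain ⟨a, ha⟩ := cauchySeq_tendsto_of_complete hre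
  obtain ⟨b, hb⟩ := cauchySeq_tendsto_of_complete him
  refine ⟨⟨a, b⟩, ?_⟩
  rw [tendsto_iff_norm_sub_tendsto_zero] at ha hb ⊢
  refine squeeze_zero (fun n => norm_nonneg _) (fun n => norm_le_re_add_im _) ?_
  simpa using ha.add hb

end Lattice

/-- `0 ≤ z` in a complex Banach lattice: `z` is real and `0 ≤ z` in the real part. -/
def IsPos {X : Type u} [AddCommGroup X] [Lattice X] (z : Complexification X) : Prop :=
  z.im = 0 ∧ 0 ≤ z.re

end Complexification

section Operators

open Complexification

variable {X : Type u} [NormedAddCommGroup X] [NormedSpace ℝ X] [Lattice X]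
  [IsOrderedAddMonoid X] [IsOrderedModule ℝ X] [HasSolidNorm X] [CompleteSpace X]

/-- A positive operator on a complex Banach lattice. -/
def IsPositiveOperator (T : Complexification X →L[ℂ] Complexification X) : Prop :=
  ∀ z, IsPos z → IsPos (T z)

/-- A positive functional on a complex Banach lattice. -/
def IsPositiveFunctional (φ : StrongDual ℂ (Complexification X)) : Prop :=
  ∀ z, IsPos z → (φ z).im = 0 ∧ 0 ≤ (φ z).re

end Operators

/-- An identification `E = F'` of the complex Banach lattice `E = Complexification X` with the dual
of the complex Banach lattice `F = Complexification Y`: an isometric linear isomorphism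
which is an isomorphism for the orders (the order of `F'` being given by positive functionals). -/
structure PredualBanachLattice (X : Type u) (Y : Type v)
    [NormedAddCommGroup X] [NormedSpace ℝ X] [CompleteSpace X] [Lattice X]
    [IsOrderedAddMonoid X] [IsOrderedModule ℝ X] [HasSolidNorm X]
    [NormedAddCommGroup Y] [NormedSpace ℝ Y] [CompleteSpace Y] [Lattice Y]
    [IsOrderedAddMonoid Y] [IsOrderedModule ℝ Y] [HasSolidNorm Y] where
  /-- the isometric isomorphism `E ≃ F'` -/
  toDual : Complexification X ≃ₗᵢ[ℂ] StrongDual ℂ (Complexification Y)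
  /-- it preserves and reflects positivity -/
  isPos_iff : ∀ z, z.IsPos ↔ IsPositiveFunctional (toDual z)

/-- `T` has a pre-adjoint: there is a bounded operator `S` on the pre-dual `F` with `S' = T`, where
`S' φ = φ ∘ S` for `φ ∈ F'`. -/
def HasPreadjoint {X : Type u} {Y : Type v}
    [NormedAddCommGroup X] [NormedSpace ℝ X] [CompleteSpace X] [Lattice X]
    [IsOrderedAddMonoid X] [IsOrderedModule ℝ X] [HasSolidNorm X]
    [NormedAddCommGroup Y] [NormedSpace ℝ Y] [CompleteSpace Y] [Lattice Y]
    [IsOrderedAddMonoid Y] [IsOrderedModule ℝ Y] [HasSolidNorm Y]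
    (D : PredualBanachLattice X Y) (T : Complexification X →L[ℂ] Complexification X) : Prop :=
  ∃ S : Complexification Y →L[ℂ] Complexification Y,
    ∀ z, D.toDual (T z) = (D.toDual z).comp S

/-! ## (WS)-bounded operators -/

/-- The `k`-th coefficient of the power series expansion of `f` around `0`. -/
noncomputable def taylorCoeff (f : ℂ → ℂ) (k : ℕ) : ℂ :=
  iteratedDeriv k f 0 / (k.factorial : ℂ)

/-- A net `(f_j)` of functions, analytic on (a neighbourhood of) the closed unit disk, is a
weighting scheme if `f_j(1) = 1`, all derivatives of `f_j` at `0` are real and nonnegative, and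
`f_j(z) → 0` for `|z| < 1`. -/
structure IsWeightingScheme {J : Type w} [Preorder J] [IsDirectedOrder J] [Nonempty J]
    (f : J → ℂ → ℂ) : Prop where
  analytic : ∀ j, AnalyticOnNhd ℂ (f j) (Metric.closedBall 0 1)
  map_one : ∀ j, f j 1 = 1
  deriv_nonneg : ∀ j k, (iteratedDeriv k (f j) 0).im = 0 ∧ 0 ≤ (iteratedDeriv k (f j) 0).re
  tendsto_zero : ∀ z : ℂ, ‖z‖ < 1 → Filter.Tendsto (fun j => f j z) Filter.atTop (nhds 0)

/-- The operator `f(T) = ∑ₖ aₖ Tᵏ`, where `f(z) = ∑ₖ aₖ zᵏ` is analytic on the closed unit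
disk and `r(T) ≤ 1`. Under these hypotheses the series converges absolutely in operator norm. -/
noncomputable def analyticCalculus {E : Type u} [NormedAddCommGroup E] [NormedSpace ℂ E]
    (f : ℂ → ℂ) (T : E →L[ℂ] E) : E →L[ℂ] E :=
  ∑' k : ℕ, taylorCoeff f k • T ^ k

/-- (WS)-boundedness of an operator `T` (with `r(T) = 1`): there is a weighting scheme `(f_j)` for
which the operators `f_j(T)` are uniformly bounded in norm. -/
def IsWSBounded {E : Type u} [NormedAddCommGroup E] [NormedSpace ℂ E] (T : E →L[ℂ] E) : Prop :=
  ∃ (J : Type w) (_ : Preorder J) (_ : IsDirectedOrder J) (_ : Nonempty J) (f : J → ℂ → ℂ),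
    IsWeightingScheme f ∧ ∃ C : ℝ, ∀ j, ‖analyticCalculus (f j) T‖ ≤ C

/-! ## Eigenspaces and the peripheral point spectrum -/

/-- `dim ker (μ - T)`, an integer or `∞`. -/
noncomputable def kerDim {E : Type u} [NormedAddCommGroup E] [NormedSpace ℂ E] (μ : ℂ)
    (T : E →L[ℂ] E) : ℕ∞ :=
  Cardinal.toENat (Module.rank ℂ
    (LinearMap.ker ((μ • ContinuousLinearMap.id ℂ E - T : E →L[ℂ] E) : E →ₗ[ℂ] E)))

/-- The peripheral point spectrum: the eigenvalues `μ` of `T` with `|μ| = r(T)`. -/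
def peripheralPointSpectrum {E : Type u} [NormedAddCommGroup E] [NormedSpace ℂ E]
    (T : E →L[ℂ] E) : Set ℂ :=
  {μ | (∃ z : E, z ≠ 0 ∧ T z = μ • z) ∧ (‖μ‖₊ : ENNReal) = spectralRadius ℂ T}

/-- A set `M` of complex numbers is cyclic if `r e^{iθ} ∈ M` implies `r e^{inθ} ∈ M` for all
integers `n`. -/
def IsCyclicSet (M : Set ℂ) : Prop :=
  ∀ r θ : ℝ, 0 ≤ r → (r : ℂ) * Complex.exp (θ * Complex.I) ∈ M →
    ∀ n : ℤ, (r : ℂ) * Complex.exp (n * θ * Complex.I) ∈ M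

/-!
# Cyclicity of the peripheral point spectrum of (WS)-bounded positive operators

Let `z` be an eigenvector of `T` for a unimodular eigenvalue. Then `|z| ≤ T |z|`, so the orbit
`Tⁿ |z|` increases. The coefficients of a weighting scheme have total mass `1` and escape to
infinity, so `f_j(T) |z|` eventually dominates almost all of `Tⁿ |z|`, and (WS)-boundedness makes
the orbit norm bounded (`PreadjointSystem.exists_norm_pow_le`). Its weak-star limit is a fixed
vector of `T` above `|z|` (`PreadjointSystem.exists_fixed_ge`), because `T` has a pre-adjoint.
Finitely many eigenvectors are thus dominated by a single fixed vector `u`.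

On the order ideal generated by `u` the orbits of `T` are order bounded, so they have weak-star
limits along every ultrafilter. Along an ultrafilter `U` on the positive integers that is idempotent
for addition, the limit of `T ^ k` is a positive projection. Its range, the space of recurrent vectors,
is a vector lattice with complete order unit norm (with suprema `lim T ^ k (x ⊔ y)`), and `T` acts
on it as an order automorphism, with inverse `lim T ^ (k - 1)`. It contains all peripheral
eigenvectors dominated by `u`, since the limit of `μ ^ k` along `U` is an idempotent of the circle
and hence equal to `1`.

By Kakutani's theorem the recurrent vectors are the continuous functions on the compact space `K` of
lattice characters, on which `T` acts by composition with a map `σ`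
(`PreadjointSystem.exists_representation`). If `g ∘ σ = μ g`, then a continuous version of `g ^ n`
(`phasePow`) satisfies the same relation with eigenvalue `μ ^ n`. From `m` independent eigenvectors
one obtains `m` points of `K` and eigenvectors `g i` that form a dual system with the evaluations at
these points (`exists_dual_points`). The powers of the `g i` are again dual to these evaluations,
hence linearly independent.

Enough lattice characters are provided by Zorn's lemma, without extreme points: a minimal sublinear
functional that preserves binary suprema is linear (`OrderUnit.IsSupSublinear.exists_le_neg_eq`).
The representation is onto by the lattice form of the Stone–Weierstrass theorem.
-/

set_option linter.unusedSectionVars false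

/-! ### Order unit spaces and their lattice characters -/

namespace OrderUnit

variable {W : Type*} [AddCommGroup W] [Module ℝ W] [Lattice W] [IsOrderedAddMonoid W]
  [IsOrderedModule ℝ W]

/-- `u` is an order unit of the vector lattice `W`, and `W` is Archimedean relative to `u`. -/
structure IsOrderUnit (u : W) : Prop where
  pos : 0 < u
  dominates : ∀ x, ∃ c : ℝ, x ≤ c • u
  archimedean : ∀ x, (∀ ε : ℝ, 0 < ε → x ≤ ε • u) → x ≤ 0

/-- The one-sided gauge `inf {t | x ≤ t u}` of an order unit `u`. -/
noncomputable def unitGauge (u x : W) : ℝ := sInf {t : ℝ | x ≤ t • u}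

variable {u : W}

theorem IsOrderUnit.smul_le_smul_iff (hu : IsOrderUnit u) {s t : ℝ} :
    s • u ≤ t • u ↔ s ≤ t := by
  refine ⟨fun h => ?_, fun h => smul_le_smul_of_nonneg_right h hu.pos.le⟩
  by_contra! hts
  have h1 : (s - t) • u ≤ 0 := by rw [sub_smul]; exact sub_nonpos.mpr h
  have h2 : (s - t)⁻¹ • ((s - t) • u) ≤ (s - t)⁻¹ • (0 : W) :=
    smul_le_smul_of_nonneg_left h1 (inv_nonneg.mpr (sub_nonneg.mpr hts.le))
  rw [inv_smul_smul₀ (sub_pos.mpr hts).ne', smul_zero] at h2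
  exact absurd h2 hu.pos.not_ge

theorem IsOrderUnit.gauge_le_iff (hu : IsOrderUnit u) {x : W} {t : ℝ} :
    unitGauge u x ≤ t ↔ x ≤ t • u := by
  have hbdd : BddBelow {t : ℝ | x ≤ t • u} := by
    obtain ⟨c, hc⟩ := hu.dominates (-x)
    refine ⟨-c, fun t ht => ?_⟩
    rw [← hu.smul_le_smul_iff, neg_smul]
    exact (neg_le.mp hc).trans ht
  have hne : {t : ℝ | x ≤ t • u}.Nonempty := hu.dominates x
  refine ⟨fun h => ?_, fun h => csInf_le hbdd h⟩
  rw [← sub_nonpos]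
  refine hu.archimedean _ fun ε hε => ?_
  obtain ⟨s, hs, hst⟩ := exists_lt_of_csInf_lt hne (lt_of_le_of_lt h (lt_add_of_pos_right t hε))
  rw [sub_le_iff_le_add', ← add_smul]
  exact le_trans hs (hu.smul_le_smul_iff.mpr hst.le)

theorem IsOrderUnit.le_gauge_smul (hu : IsOrderUnit u) (x : W) : x ≤ unitGauge u x • u :=
  hu.gauge_le_iff.mp le_rfl

theorem IsOrderUnit.gauge_smul_unit (hu : IsOrderUnit u) (t : ℝ) : unitGauge u (t • u) = t :=
  le_antisymm (hu.gauge_le_iff.mpr le_rfl)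
    (hu.smul_le_smul_iff.mp (hu.le_gauge_smul (t • u)))

/-- A sublinear functional below the gauge of `u` that preserves binary suprema. On a space of
continuous functions these are the functionals `f ↦ max f(S)` over closed sets `S`, so that
the minimal ones are the point evaluations. -/
structure IsSupSublinear (u : W) (q : W → ℝ) : Prop where
  add_le : ∀ x y, q (x + y) ≤ q x + q y
  smul_le : ∀ t : ℝ, 0 < t → ∀ x, q (t • x) ≤ t * q x
  sup_le : ∀ x y, q (x ⊔ y) ≤ max (q x) (q y)
  le_gauge : ∀ x, q x ≤ unitGauge u x

theorem IsOrderUnit.isSupSublinear_gauge (hu : IsOrderUnit u) :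
    IsSupSublinear u (unitGauge u) where
  add_le x y := by
    rw [hu.gauge_le_iff, add_smul]
    exact add_le_add (hu.le_gauge_smul x) (hu.le_gauge_smul y)
  smul_le t ht x := by
    rw [hu.gauge_le_iff, mul_smul]
    exact smul_le_smul_of_nonneg_left (hu.le_gauge_smul x) ht.le
  sup_le x y := by
    rw [hu.gauge_le_iff]
    exact _root_.sup_le ((hu.le_gauge_smul x).trans (hu.smul_le_smul_iff.mpr (le_max_left _ _)))
      ((hu.le_gauge_smul y).trans (hu.smul_le_smul_iff.mpr (le_max_right _ _)))
  le_gauge _ := le_rfl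

namespace IsSupSublinear

variable {q : W → ℝ}

theorem map_zero (hu : IsOrderUnit u) (hq : IsSupSublinear u q) : q 0 = 0 := by
  have h1 := hq.smul_le 2 two_pos 0
  rw [smul_zero] at h1
  have h2 := hq.le_gauge 0
  have h3 := hu.gauge_smul_unit 0
  rw [zero_smul] at h3
  linarith

theorem neg_le (hu : IsOrderUnit u) (hq : IsSupSublinear u q) (x : W) : -q (-x) ≤ q x := by
  have h := hq.add_le x (-x)
  rw [add_neg_cancel, hq.map_zero hu] at h
  linarith

theorem map_add_smul_unit (hu : IsOrderUnit u) (hq : IsSupSublinear u q) (x : W) (t : ℝ) :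
    q (x + t • u) = q x + t := by
  have key : ∀ (y : W) (s : ℝ), q (y + s • u) ≤ q y + s := fun y s =>
    (hq.add_le _ _).trans (add_le_add_right ((hq.le_gauge _).trans_eq (hu.gauge_smul_unit s)) _)
  refine le_antisymm (key x t) ?_
  have h := key (x + t • u) (-t)
  rw [neg_smul, add_neg_cancel_right] at h
  linarith

theorem mono (hu : IsOrderUnit u) (hq : IsSupSublinear u q) {x y : W} (h : x ≤ y) :
    q x ≤ q y := by
  have h1 := hq.add_le y (x - y)
  have h2 : unitGauge u (x - y) ≤ 0 := by
    rw [hu.gauge_le_iff, zero_smul]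
    exact sub_nonpos.mpr h
  have h3 := hq.le_gauge (x - y)
  rw [add_sub_cancel] at h1
  linarith

/-- The infimum of a family which is downward directed, in a sense compatible with each of the
three defining inequalities, is again sup-preserving and sublinear. -/
theorem iInf {ι : Type*} [Nonempty ι] {r : ι → W → ℝ}
    (hbdd : ∀ x, BddBelow (Set.range fun i => r i x))
    (hadd : ∀ i j, ∃ k, ∀ x y, r k (x + y) ≤ r i x + r j y)
    (hsmul : ∀ i, ∀ t : ℝ, 0 < t → ∃ k, ∀ x, r k (t • x) ≤ t * r i x)
    (hsup : ∀ i j, ∃ k, ∀ x y, r k (x ⊔ y) ≤ max (r i x) (r j y))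
    (hgauge : ∃ i, ∀ x, r i x ≤ unitGauge u x) :
    IsSupSublinear u fun x => ⨅ i, r i x where
  add_le x y := by
    refine le_ciInf_add_ciInf fun i j => ?_
    obtain ⟨k, hk⟩ := hadd i j
    exact (ciInf_le (hbdd _) k).trans (hk x y)
  smul_le t ht x := by
    rw [Real.mul_iInf_of_nonneg ht.le]
    refine le_ciInf fun i => ?_
    obtain ⟨k, hk⟩ := hsmul i t ht
    exact (ciInf_le (hbdd _) k).trans (hk x)
  sup_le x y := by
    by_contra! h
    rw [max_lt_iff] at h
    obtain ⟨i, hi⟩ := exists_lt_of_ciInf_lt h.1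
    obtain ⟨j, hj⟩ := exists_lt_of_ciInf_lt h.2
    obtain ⟨k, hk⟩ := hsup i j
    exact absurd ((ciInf_le (hbdd _) k).trans (hk x y)) (max_lt hi hj).not_ge
  le_gauge x := by
    obtain ⟨i, hi⟩ := hgauge
    exact (ciInf_le (hbdd x) i).trans (hi x)

/-- Restriction of `q` to the part of its support where `w` is maximal: below `q` there is a
sup-preserving sublinear functional `q'` with `q' (-w) ≤ -q w`. -/
theorem exists_le_neg (hu : IsOrderUnit u) (hq : IsSupSublinear u q) (w : W) :
    ∃ q', IsSupSublinear u q' ∧ q' ≤ q ∧ q' (-w) ≤ -q w := by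
  set c : W := w + (-q w) • u with hc
  have hqc : q c = 0 := by rw [hc, hq.map_add_smul_unit hu]; ring
  have hqs : ∀ s : NNReal, q ((s : ℝ) • c) ≤ 0 := by
    intro s
    rcases eq_or_lt_of_le s.coe_nonneg with h | h
    · rw [← h, zero_smul, hq.map_zero hu]
    · simpa [hqc] using hq.smul_le s h c
  have hanti : ∀ (s t : NNReal) (x : W), q (x + ((s + t : NNReal) : ℝ) • c) ≤
      q (x + (s : ℝ) • c) := by
    intro s t x
    have h := hq.add_le (x + (s : ℝ) • c) ((t : ℝ) • c)
    have e : x + (s : ℝ) • c + (t : ℝ) • c = x + ((s + t : NNReal) : ℝ) • c := by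
      push_cast; module
    rw [e] at h
    linarith [hqs t]
  have hanti' : ∀ (s t : NNReal) (x : W), q (x + ((s + t : NNReal) : ℝ) • c) ≤
      q (x + (t : ℝ) • c) := fun s t x => by rw [add_comm s t]; exact hanti t s x
  have hbdd : ∀ x, BddBelow (Set.range fun s : NNReal => q (x + (s : ℝ) • c)) := by
    intro x
    refine ⟨-q (-x), ?_⟩
    rintro _ ⟨s, rfl⟩
    have hz : 0 ≤ q ((s : ℝ) • c) := by
      rcases eq_or_lt_of_le s.coe_nonneg with h | h
      · rw [← h, zero_smul, hq.map_zero hu]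
      · have h1 := hq.smul_le (s : ℝ)⁻¹ (inv_pos.mpr h) ((s : ℝ) • c)
        rw [inv_smul_smul₀ h.ne', hqc] at h1
        exact nonneg_of_mul_nonneg_right h1 (inv_pos.mpr h)
    have h2 := hq.add_le (x + (s : ℝ) • c) (-x)
    have e : x + (s : ℝ) • c + -x = (s : ℝ) • c := by abel
    rw [e] at h2
    change -q (-x) ≤ q (x + (s : ℝ) • c)
    linarith
  refine ⟨fun x => ⨅ s : NNReal, q (x + (s : ℝ) • c),
    iInf hbdd (fun s t => ⟨s + t, fun x y => ?_⟩) (fun s t ht => ⟨t.toNNReal * s, fun x => ?_⟩)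
      (fun s t => ⟨s + t, fun x y => ?_⟩) ⟨0, fun x => ?_⟩, fun x => ?_, ?_⟩
  · have e : x + y + ((s + t : NNReal) : ℝ) • c = (x + (s : ℝ) • c) + (y + (t : ℝ) • c) := by
      push_cast; module
    rw [e]
    exact hq.add_le _ _
  · have e : t • x + ((t.toNNReal * s : NNReal) : ℝ) • c = t • (x + (s : ℝ) • c) := by
      push_cast
      rw [Real.coe_toNNReal t ht.le]; module
    rw [e]
    exact hq.smul_le t ht _
  · rw [sup_add]
    exact (hq.sup_le _ _).trans (max_le_max (hanti s t x) (hanti' s t y))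
  · simpa using hq.le_gauge x
  · simpa using ciInf_le (hbdd x) 0
  · refine (ciInf_le (hbdd (-w)) 1).trans ?_
    have e : -w + ((1 : NNReal) : ℝ) • c = 0 + (-q w) • u := by
      rw [hc]; push_cast; module
    change q (-w + ((1 : NNReal) : ℝ) • c) ≤ _
    rw [e, hq.map_add_smul_unit hu, hq.map_zero hu, zero_add]

theorem exists_le_minimal (hu : IsOrderUnit u) (hq : IsSupSublinear u q) :
    ∃ φ, φ ≤ q ∧ Minimal (IsSupSublinear u) φ := by
  refine @zorn_le_nonempty₀ (W → ℝ)ᵒᵈ _ {r | IsSupSublinear u r} ?_ q hq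
  intro (C : Set (W → ℝ)) (hC : C ⊆ {r | IsSupSublinear u r}) hchain (r₀ : W → ℝ)
    (hr₀ : r₀ ∈ C)
  have : Nonempty C := ⟨⟨r₀, hr₀⟩⟩
  have hbdd : ∀ x, BddBelow (Set.range fun r : C => (r : W → ℝ) x) := by
    intro x
    refine ⟨-unitGauge u (-x), ?_⟩
    rintro _ ⟨r, rfl⟩
    exact (neg_le_neg ((hC r.2).le_gauge (-x))).trans (neg_le hu (hC r.2) x)
  have hdir : ∀ r s : C, ∃ k : C, (∀ x, (k : W → ℝ) x ≤ (r : W → ℝ) x) ∧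
      ∀ x, (k : W → ℝ) x ≤ (s : W → ℝ) x := by
    intro r s
    rcases hchain.total r.2 s.2 with h | h
    · exact ⟨s, fun x => h x, fun x => le_rfl⟩
    · exact ⟨r, fun x => le_rfl, fun x => h x⟩
  refine ⟨fun x => ⨅ r : C, (r : W → ℝ) x, iInf hbdd (fun r s => ?_)
    (fun r t ht => ⟨r, (hC r.2).smul_le t ht⟩) (fun r s => ?_)
    ⟨⟨r₀, hr₀⟩, (hC hr₀).le_gauge⟩, fun r hr x => ciInf_le (hbdd x) ⟨r, hr⟩⟩
  · obtain ⟨k, hk1, hk2⟩ := hdir r s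
    exact ⟨k, fun x y => ((hC k.2).add_le x y).trans (add_le_add (hk1 x) (hk2 y))⟩
  · obtain ⟨k, hk1, hk2⟩ := hdir r s
    exact ⟨k, fun x y => ((hC k.2).sup_le x y).trans (max_le_max (hk1 x) (hk2 y))⟩

/-- Below every sup-preserving sublinear functional there is one which is linear. -/
theorem exists_le_neg_eq (hu : IsOrderUnit u) (hq : IsSupSublinear u q) :
    ∃ φ, IsSupSublinear u φ ∧ φ ≤ q ∧ ∀ x, φ (-x) = -φ x := by
  obtain ⟨φ, hφq, hφ⟩ := hq.exists_le_minimal hu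
  refine ⟨φ, hφ.prop, hφq, fun x => ?_⟩
  obtain ⟨ψ, hψ, hle, hx⟩ := exists_le_neg hu hφ.prop x
  exact le_antisymm ((hφ.le_of_le hψ hle (-x)).trans hx) (by linarith [neg_le hu hφ.prop x])

end IsSupSublinear

/-- A lattice character: a linear lattice homomorphism to `ℝ` that maps the order unit to `1`. -/
structure IsLatticeCharacter (u : W) (φ : W → ℝ) : Prop where
  map_add : ∀ x y, φ (x + y) = φ x + φ y
  map_smul : ∀ (t : ℝ) (x), φ (t • x) = t * φ x
  map_sup : ∀ x y, φ (x ⊔ y) = max (φ x) (φ y)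
  map_unit : φ u = 1

namespace IsLatticeCharacter

variable {φ : W → ℝ}

theorem map_neg (hφ : IsLatticeCharacter u φ) (x : W) : φ (-x) = -φ x := by
  simpa using hφ.map_smul (-1) x

theorem map_sub (hφ : IsLatticeCharacter u φ) (x y : W) : φ (x - y) = φ x - φ y := by
  rw [sub_eq_add_neg, hφ.map_add, hφ.map_neg, ← sub_eq_add_neg]

theorem mono (hφ : IsLatticeCharacter u φ) {x y : W} (h : x ≤ y) : φ x ≤ φ y := by
  have := hφ.map_sup x y
  rw [sup_eq_right.mpr h] at this
  exact this ▸ le_max_left _ _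

theorem map_inf (hφ : IsLatticeCharacter u φ) (x y : W) : φ (x ⊓ y) = min (φ x) (φ y) := by
  have h := hφ.map_sup (-x) (-y)
  rw [← neg_inf, hφ.map_neg, hφ.map_neg, hφ.map_neg, max_neg_neg] at h
  linarith

theorem le_of_le_smul (hφ : IsLatticeCharacter u φ) {x : W} {t : ℝ} (h : x ≤ t • u) :
    φ x ≤ t := by
  have := hφ.mono h
  rwa [hφ.map_smul, hφ.map_unit, mul_one] at this

end IsLatticeCharacter

/-- There are enough lattice characters: the gauge of `x` is attained at one of them. -/
theorem IsOrderUnit.exists_character (hu : IsOrderUnit u) (x : W) :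
    ∃ φ, IsLatticeCharacter u φ ∧ unitGauge u x ≤ φ x := by
  obtain ⟨q, hq, -, hqx⟩ := hu.isSupSublinear_gauge.exists_le_neg hu x
  obtain ⟨φ, hφ, hφq, hneg⟩ := hq.exists_le_neg_eq hu
  have hadd : ∀ x y, φ (x + y) = φ x + φ y := by
    intro x y
    refine le_antisymm (hφ.add_le x y) ?_
    have h := hφ.add_le (-x) (-y)
    rw [← neg_add, hneg, hneg, hneg] at h
    linarith
  have hpos : ∀ t : ℝ, 0 < t → ∀ x, φ (t • x) = t * φ x := by
    intro t ht x
    refine le_antisymm (hφ.smul_le t ht x) ?_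
    have h := hφ.smul_le t ht (-x)
    rw [smul_neg, hneg, hneg] at h
    linarith
  refine ⟨φ, ⟨hadd, fun t x => ?_, fun x y => le_antisymm (hφ.sup_le x y) ?_, ?_⟩, ?_⟩
  · rcases lt_trichotomy t 0 with ht | rfl | ht
    · have h := hpos (-t) (neg_pos.mpr ht) x
      rw [neg_smul, hneg] at h
      linarith
    · rw [zero_smul, zero_mul, hφ.map_zero hu]
    · exact hpos t ht x
  · exact max_le (hφ.mono hu le_sup_left) (hφ.mono hu le_sup_right)
  · have h := hφ.map_add_smul_unit hu 0 1
    rwa [hφ.map_zero hu, zero_add, zero_add, one_smul] at h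
  · have h := (hφq (-x)).trans hqx
    rw [hneg] at h
    linarith

/-! ### Kakutani's representation theorem -/

/-- The space of lattice characters, with the topology of pointwise convergence. -/
abbrev Character (u : W) : Type _ := {φ : W → ℝ // IsLatticeCharacter u φ}

theorem IsOrderUnit.compactSpace_character (hu : IsOrderUnit u) :
    CompactSpace (Character u) := by
  refine (isCompact_iff_compactSpace (s := {φ : W → ℝ | IsLatticeCharacter u φ})).mp ?_
  refine (isCompact_univ_pi fun x : W =>
    isCompact_Icc (a := -unitGauge u (-x)) (b := unitGauge u x)).of_isClosed_subset ?_ ?_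
  · have e : {φ : W → ℝ | IsLatticeCharacter u φ} =
        {φ | (∀ x y, φ (x + y) = φ x + φ y) ∧ (∀ (t : ℝ) (x), φ (t • x) = t * φ x) ∧
          (∀ x y, φ (x ⊔ y) = max (φ x) (φ y)) ∧ φ u = 1} := by
      ext φ
      exact ⟨fun h => ⟨h.1, h.2, h.3, h.4⟩, fun h => ⟨h.1, h.2.1, h.2.2.1, h.2.2.2⟩⟩
    rw [e]
    simp only [Set.ofPred_and, Set.ofPred_forall]
    refine IsClosed.inter (isClosed_iInter fun x => isClosed_iInter fun y => ?_) (IsClosed.inter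
      (isClosed_iInter fun t => isClosed_iInter fun x => ?_) (IsClosed.inter
      (isClosed_iInter fun x => isClosed_iInter fun y => ?_) ?_)) <;>
    exact isClosed_eq (by fun_prop) (by fun_prop)
  · intro φ hφ x _
    refine ⟨?_, IsLatticeCharacter.le_of_le_smul hφ (hu.le_gauge_smul x)⟩
    rw [neg_le, ← IsLatticeCharacter.map_neg hφ]
    exact IsLatticeCharacter.le_of_le_smul hφ (hu.le_gauge_smul (-x))

/-- The continuous function on the character space represented by a vector. -/
def eval (u x : W) : C(Character u, ℝ) where
  toFun φ := φ.1 x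
  continuous_toFun := (continuous_apply x).comp continuous_subtype_val

@[simp] theorem eval_apply (x : W) (φ : Character u) : eval u x φ = φ.1 x := rfl

theorem IsOrderUnit.le_of_forall_character (hu : IsOrderUnit u) {x : W} {t : ℝ}
    (h : ∀ φ : Character u, φ.1 x ≤ t) : x ≤ t • u := by
  obtain ⟨φ, hφ, hx⟩ := hu.exists_character x
  exact hu.gauge_le_iff.mp (hx.trans (h ⟨φ, hφ⟩))

theorem IsOrderUnit.ext_character (hu : IsOrderUnit u) {x y : W}
    (h : ∀ φ : Character u, φ.1 x = φ.1 y) : x = y := by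
  have key : ∀ a b : W, (∀ φ : Character u, φ.1 a = φ.1 b) → a ≤ b := by
    intro a b hab
    have h0 : a - b ≤ (0 : ℝ) • u := hu.le_of_forall_character fun φ => by
      rw [φ.2.map_sub, hab φ, sub_self]
    rwa [zero_smul, sub_nonpos] at h0
  exact le_antisymm (key x y h) (key y x fun φ => (h φ).symm)

/-- Every continuous function on the character space is represented by a vector, if the order
unit space is complete. -/
theorem IsOrderUnit.eval_surjective (hu : IsOrderUnit u)
    (hcomplete : ∀ a : ℕ → W,
      (∀ ε : ℝ, 0 < ε → ∃ N, ∀ m ≥ N, ∀ n ≥ N, a m - a n ≤ ε • u) →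
        ∃ x, ∀ ε : ℝ, 0 < ε → ∃ N, ∀ n ≥ N, a n - x ≤ ε • u ∧ x - a n ≤ ε • u) :
    Function.Surjective (eval u) := by
  have := hu.compactSpace_character
  have hdense : closure (Set.range (eval u)) = ⊤ := by
    refine ContinuousMap.sublattice_closure_eq_top _ ⟨_, 0, rfl⟩ ?_ ?_ ?_
    · rintro _ ⟨x, rfl⟩ _ ⟨y, rfl⟩
      exact ⟨x ⊓ y, ContinuousMap.ext fun φ => φ.2.map_inf x y⟩
    · rintro _ ⟨x, rfl⟩ _ ⟨y, rfl⟩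
      exact ⟨x ⊔ y, ContinuousMap.ext fun φ => φ.2.map_sup x y⟩
    · intro v φ ψ
      rcases eq_or_ne φ ψ with rfl | hne
      · refine ⟨_, ⟨v φ • u, rfl⟩, ?_, ?_⟩ <;> simp [φ.2.map_smul, φ.2.map_unit]
      · obtain ⟨x, hx⟩ : ∃ x, φ.1 x ≠ ψ.1 x := by
          by_contra! h
          exact hne (Subtype.ext (funext h))
        have hx' : φ.1 x - ψ.1 x ≠ 0 := sub_ne_zero.mpr hx
        set b : ℝ := (v φ - v ψ) / (φ.1 x - ψ.1 x) with hb
        have hb' : b * (φ.1 x - ψ.1 x) = v φ - v ψ := div_mul_cancel₀ _ hx'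
        refine ⟨_, ⟨b • x + (v φ - b * φ.1 x) • u, rfl⟩, ?_, ?_⟩
        · simp only [eval_apply, φ.2.map_add, φ.2.map_smul, φ.2.map_unit]
          ring
        · simp only [eval_apply, ψ.2.map_add, ψ.2.map_smul, ψ.2.map_unit]
          linarith
  intro f
  have hf : ∀ n : ℕ, ∃ x : W, dist f (eval u x) < 1 / ((n : ℝ) + 1) := by
    intro n
    have : f ∈ closure (Set.range (eval u)) := hdense ▸ Set.mem_univ f
    obtain ⟨_, ⟨x, rfl⟩, hx⟩ := Metric.mem_closure_iff.mp this _ (Nat.one_div_pos_of_nat (n := n))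
    exact ⟨x, hx⟩
  choose a ha using hf
  have hclose : ∀ ε : ℝ, 0 < ε → ∃ N, ∀ n ≥ N, ∀ φ : Character u, |f φ - φ.1 (a n)| ≤ ε := by
    intro ε hε
    obtain ⟨N, hN⟩ := exists_nat_one_div_lt hε
    refine ⟨N, fun n hn φ => ?_⟩
    have h1 : |f φ - φ.1 (a n)| ≤ dist f (eval u (a n)) := by
      simpa [Real.dist_eq] using ContinuousMap.dist_apply_le_dist (f := f) (g := eval u (a n)) φ
    have h2 : 1 / ((n : ℝ) + 1) ≤ 1 / ((N : ℝ) + 1) := Nat.one_div_le_one_div hn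
    linarith [ha n]
  obtain ⟨x, hx⟩ := hcomplete a fun ε hε => by
    obtain ⟨N, hN⟩ := hclose (ε / 2) (half_pos hε)
    refine ⟨N, fun m hm n hn => hu.le_of_forall_character fun φ => ?_⟩
    have h1 := abs_le.mp (hN m hm φ)
    have h2 := abs_le.mp (hN n hn φ)
    rw [φ.2.map_sub]
    linarith
  refine ⟨x, ContinuousMap.ext fun φ => ?_⟩
  refine eq_of_forall_dist_le fun ε hε => ?_
  obtain ⟨N, hN⟩ := hclose (ε / 2) (half_pos hε)
  obtain ⟨M, hM⟩ := hx (ε / 2) (half_pos hε)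
  have h1 := abs_le.mp (hN (max N M) (le_max_left _ _) φ)
  obtain ⟨h2, h3⟩ := hM (max N M) (le_max_right _ _)
  have h2' := φ.2.le_of_le_smul h2
  have h3' := φ.2.le_of_le_smul h3
  rw [φ.2.map_sub] at h2' h3'
  rw [Real.dist_eq, eval_apply, abs_le]
  constructor <;> linarith

end OrderUnit

/-! ### Positive operators on dual lattices and their recurrent vectors -/

open Filter Topology

/-- An ultrafilter on the positive integers that is idempotent for addition. -/
def IsIdempotentUltrafilter (U : Ultrafilter ℕ+) : Prop :=
  ∀ p : ℕ+ → Prop, (∀ᶠ m in U, p m) ↔ ∀ᶠ l in U, ∀ᶠ k in U, p (l + k)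

theorem exists_isIdempotentUltrafilter : ∃ U : Ultrafilter ℕ+, IsIdempotentUltrafilter U := by
  let _ : AddSemigroup (Ultrafilter ℕ+) := Ultrafilter.addSemigroup
  obtain ⟨U, hU⟩ := exists_idempotent_of_compact_t2_of_continuous_add_left
    (@Ultrafilter.continuous_add_left ℕ+ _)
  refine ⟨U, fun p => ?_⟩
  have h := Ultrafilter.eventually_add U U p
  rw [show @HAdd.hAdd _ _ _ (@instHAdd _ Ultrafilter.add) U U = U from hU] at h
  exact h

/-- Along an idempotent ultrafilter an iterated limit of `a (l + k)` agrees with the limit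
of `a`. -/
theorem IsIdempotentUltrafilter.tendsto_iterated {U : Ultrafilter ℕ+}
    (hU : IsIdempotentUltrafilter U) {M : Type*} [TopologicalSpace M] [RegularSpace M]
    {a b : ℕ+ → M} {c : M} (ha : Tendsto a U (𝓝 c))
    (hb : ∀ l, Tendsto (fun k => a (l + k)) U (𝓝 (b l))) : Tendsto b U (𝓝 c) := by
  refine (closed_nhds_basis c).tendsto_right_iff.mpr fun s hs => ?_
  have h1 : ∀ᶠ m in U, a m ∈ s := ha hs.1
  rw [hU] at h1
  filter_upwards [h1] with l hl
  exact hs.2.mem_of_tendsto (hb l) hl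

/-- An idempotent ultrafilter does not see unimodular characters of the positive integers. -/
theorem IsIdempotentUltrafilter.tendsto_pow {U : Ultrafilter ℕ+}
    (hU : IsIdempotentUltrafilter U) {μ : ℂ} (hμ : ‖μ‖ = 1) :
    Tendsto (fun k : ℕ+ => μ ^ (k : ℕ)) U (𝓝 1) := by
  obtain ⟨c, hc, hlim⟩ : ∃ c ∈ Metric.sphere (0 : ℂ) 1,
      Tendsto (fun k : ℕ+ => μ ^ (k : ℕ)) U (𝓝 c) := by
    have h := (isCompact_sphere (0 : ℂ) 1).ultrafilter_le_nhds
      (U.map fun k : ℕ+ => μ ^ (k : ℕ))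
    refine h ?_
    rw [Ultrafilter.coe_map, le_principal_iff, mem_map]
    refine univ_mem' fun k => ?_
    simp [hμ]
  have h1 : Tendsto (fun l : ℕ+ => μ ^ (l : ℕ) * c) U (𝓝 c) := by
    refine hU.tendsto_iterated hlim fun l => ?_
    simp only [PNat.add_coe, pow_add]
    exact hlim.const_mul _
  have h2 : c * c = c := tendsto_nhds_unique (hlim.mul_const c) h1
  have hc0 : c ≠ 0 := by
    rintro rfl
    simp at hc
  rwa [mul_left_cancel₀ hc0 (h2.trans (mul_one c).symm)] at hlim

/-- A positive operator with a pre-adjoint on a dual lattice, described by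
the functionals coming from the pre-dual: `cone` consists of the positive elements of the pre-dual,
norm bounded families have ultralimits for the weak topology of the functionals, and the operator is
continuous for that topology. -/
structure PreadjointSystem (X : Type*) (I : Type*) [NormedAddCommGroup X] [NormedSpace ℝ X]
    [Lattice X] where
  /-- the functionals coming from the pre-dual -/
  functional : I → X →ₗ[ℝ] ℝ
  /-- the positive elements of the pre-dual -/
  cone : Set I
  nonneg_iff : ∀ x, 0 ≤ x ↔ ∀ i ∈ cone, 0 ≤ functional i x
  exists_limit : ∀ {J : Type} (U : Ultrafilter J) (a : J → X) (C : ℝ), (∀ j, ‖a j‖ ≤ C) →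
    ∃ y, ∀ i, Tendsto (fun j => functional i (a j)) U (𝓝 (functional i y))
  /-- the positive operator -/
  op : X →ₗ[ℝ] X
  op_nonneg : ∀ x, 0 ≤ x → 0 ≤ op x
  exists_preadjoint : ∀ i, ∃ j, ∀ x, functional i (op x) = functional j x

namespace PreadjointSystem

variable {X : Type u} {I : Type v} [NormedAddCommGroup X] [NormedSpace ℝ X] [Lattice X]
  [IsOrderedAddMonoid X] [IsOrderedModule ℝ X] [HasSolidNorm X]
  (D : PreadjointSystem X I)

theorem le_iff {x y : X} : x ≤ y ↔ ∀ i ∈ D.cone, D.functional i x ≤ D.functional i y := by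
  rw [← sub_nonneg, D.nonneg_iff]
  simp only [map_sub, sub_nonneg]

theorem ext_functional {x y : X} (h : ∀ i ∈ D.cone, D.functional i x = D.functional i y) :
    x = y :=
  le_antisymm (D.le_iff.mpr fun i hi => (h i hi).le) (D.le_iff.mpr fun i hi => (h i hi).ge)

theorem le_of_tendsto {J : Type*} {U : Ultrafilter J} {a b : J → X} {x y : X}
    (ha : ∀ i, Tendsto (fun j => D.functional i (a j)) U (𝓝 (D.functional i x)))
    (hb : ∀ i, Tendsto (fun j => D.functional i (b j)) U (𝓝 (D.functional i y)))
    (h : ∀ j, a j ≤ b j) : x ≤ y :=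
  D.le_iff.mpr fun i hi => le_of_tendsto_of_tendsto' (ha i) (hb i) fun j => D.le_iff.mp (h j) i hi

theorem pow_nonneg (n : ℕ) {x : X} (h : 0 ≤ x) : 0 ≤ (D.op ^ n) x := by
  induction n with
  | zero => simpa using h
  | succ n ih =>
    rw [pow_succ', Module.End.mul_apply]
    exact D.op_nonneg _ ih

theorem pow_mono (n : ℕ) {x y : X} (h : x ≤ y) : (D.op ^ n) x ≤ (D.op ^ n) y := by
  rw [← sub_nonneg, ← map_sub]
  exact D.pow_nonneg n (sub_nonneg.mpr h)

theorem op_mono {x y : X} (h : x ≤ y) : D.op x ≤ D.op y := by simpa using D.pow_mono 1 h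

theorem abs_pow_le (n : ℕ) (x : X) : |(D.op ^ n) x| ≤ (D.op ^ n) |x| := by
  rw [abs_le', ← map_neg]
  exact ⟨D.pow_mono n (le_abs_self x), D.pow_mono n (neg_le_abs x)⟩

theorem exists_preadjoint_pow (n : ℕ) (i : I) :
    ∃ j, ∀ x, D.functional i ((D.op ^ n) x) = D.functional j x := by
  induction n generalizing i with
  | zero => exact ⟨i, fun x => by simp⟩
  | succ n ih =>
    obtain ⟨j, hj⟩ := D.exists_preadjoint i
    obtain ⟨k, hk⟩ := ih j
    exact ⟨k, fun x => by rw [pow_succ', Module.End.mul_apply, hj, hk]⟩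

theorem pow_fixed {u : X} (hfix : D.op u = u) (n : ℕ) : (D.op ^ n) u = u := by
  rw [Module.End.pow_apply]
  exact Function.iterate_fixed hfix n

/-- If the orbit of `x ≤ T x` is norm bounded, then its weak limit is a fixed vector
above `x`. -/
theorem exists_fixed_ge {x : X} (hx : x ≤ D.op x) {C : ℝ} (hC : ∀ n, ‖(D.op ^ n) x‖ ≤ C) :
    ∃ u, x ≤ u ∧ D.op u = u := by
  obtain ⟨u, hu⟩ := D.exists_limit (hyperfilter ℕ) (fun n => (D.op ^ n) x) C hC
  have hmono : Monotone fun n => (D.op ^ n) x := monotone_nat_of_le_succ fun n => by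
    rw [pow_succ, Module.End.mul_apply]
    exact D.pow_mono n hx
  refine ⟨u, D.le_of_tendsto (fun i => tendsto_const_nhds) hu fun n => ?_,
    D.ext_functional fun i hi => ?_⟩
  · simpa using hmono (Nat.zero_le n)
  -- For positive `i` the scalar sequence is monotone and bounded, so it converges and its shift has
  -- the same limit.
  have hmono' : Monotone fun n => D.functional i ((D.op ^ n) x) :=
    fun m n h => D.le_iff.mp (hmono h) i hi
  have hle : ∀ n, D.functional i ((D.op ^ n) x) ≤ D.functional i u := by
    intro n
    refine ge_of_tendsto (hu i) ?_
    have h : ∀ᶠ m in (hyperfilter ℕ : Filter ℕ), n ≤ m :=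
      Nat.hyperfilter_le_atTop (eventually_ge_atTop n)
    exact h.mono fun m hm => hmono' hm
  have hlim := tendsto_atTop_ciSup hmono' ⟨_, by rintro _ ⟨n, rfl⟩; exact hle n⟩
  have e := tendsto_nhds_unique (hu i) (hlim.mono_left Nat.hyperfilter_le_atTop)
  rw [← e] at hlim
  obtain ⟨j, hj⟩ := D.exists_preadjoint i
  have h1 : Tendsto (fun n => D.functional i ((D.op ^ (n + 1)) x)) (hyperfilter ℕ)
      (𝓝 (D.functional i (D.op u))) := by
    rw [hj]
    refine (hu j).congr fun n => ?_
    rw [pow_succ', Module.End.mul_apply, hj]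
  exact tendsto_nhds_unique h1
    (((tendsto_add_atTop_iff_nat 1).mpr hlim).mono_left Nat.hyperfilter_le_atTop)

/-- The vectors `x` of the order ideal generated by `u` that are recurrent along
the ultrafilter `U`: the weak limit of `T ^ k x` along `U` is `x`. -/
def recurrent (u : X) (U : Ultrafilter ℕ+) : Submodule ℝ X where
  carrier := {x | (∃ c : ℝ, |x| ≤ c • u) ∧
    ∀ i, Tendsto (fun k : ℕ+ => D.functional i ((D.op ^ (k : ℕ)) x)) U (𝓝 (D.functional i x))}
  add_mem' := by
    rintro x y ⟨⟨c, hc⟩, hx⟩ ⟨⟨d, hd⟩, hy⟩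
    refine ⟨⟨c + d, ?_⟩, fun i => ?_⟩
    · rw [add_smul]
      exact (abs_add_le x y).trans (add_le_add hc hd)
    · simpa using (hx i).add (hy i)
  zero_mem' := ⟨⟨0, by simp⟩, fun i => by simp⟩
  smul_mem' := by
    rintro t x ⟨⟨c, hc⟩, hx⟩
    refine ⟨⟨|t| * c, ?_⟩, fun i => ?_⟩
    · have h : |t • x| ≤ |t| • |x| := by
        refine abs_le'.mpr ⟨Complexification.smul_le_abs_smul_abs t x, ?_⟩
        have := Complexification.smul_le_abs_smul_abs (-t) x
        rwa [neg_smul, abs_neg] at this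
      rw [mul_smul]
      exact h.trans (smul_le_smul_of_nonneg_left hc (abs_nonneg t))
    · simpa using (hx i).const_mul t

variable {D} {u : X} {U : Ultrafilter ℕ+}

/-- The limits of `T ^ k x` and of `T ^ (k - 1) x` along an idempotent ultrafilter are
recurrent. -/
theorem exists_mem_recurrent (hfix : D.op u = u) (hU : IsIdempotentUltrafilter U) {x : X} {c : ℝ}
    (hx : |x| ≤ c • u) {s : ℕ} (hs : s ≤ 1) :
    ∃ y ∈ D.recurrent u U, ∀ i,
      Tendsto (fun k : ℕ+ => D.functional i ((D.op ^ ((k : ℕ) - s)) x)) U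
        (𝓝 (D.functional i y)) := by
  have hbd : ∀ n, |(D.op ^ n) x| ≤ c • u := fun n => by
    refine (D.abs_pow_le n x).trans ((D.pow_mono n hx).trans_eq ?_)
    rw [map_smul, D.pow_fixed hfix]
  obtain ⟨y, hy⟩ := D.exists_limit U (fun k : ℕ+ => (D.op ^ ((k : ℕ) - s)) x) ‖c • u‖ fun k =>
    norm_le_norm_of_abs_le_abs ((hbd _).trans (le_abs_self _))
  refine ⟨y, ⟨⟨c, abs_le'.mpr ⟨?_, ?_⟩⟩, fun i => ?_⟩, hy⟩
  · exact D.le_of_tendsto hy (fun i => tendsto_const_nhds) fun k => (le_abs_self _).trans (hbd _)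
  · refine D.le_of_tendsto (U := U) (a := fun k : ℕ+ => -(D.op ^ ((k : ℕ) - s)) x) (fun i => ?_)
      (fun i => tendsto_const_nhds) fun k => (neg_le_abs _).trans (hbd _)
    simpa using (hy i).neg
  · refine hU.tendsto_iterated (hy i) fun l => ?_
    obtain ⟨j, hj⟩ := D.exists_preadjoint_pow (l : ℕ) i
    rw [hj]
    refine (hy j).congr fun k => ?_
    have hk : ((l + k : ℕ+) : ℕ) - s = (l : ℕ) + ((k : ℕ) - s) := by
      have := k.pos
      rw [PNat.add_coe]
      omega
    rw [hk, pow_add, Module.End.mul_apply, hj]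

theorem op_mem_recurrent (hfix : D.op u = u) {x : X} (hx : x ∈ D.recurrent u U) :
    D.op x ∈ D.recurrent u U := by
  obtain ⟨⟨c, hc⟩, hrec⟩ := hx
  refine ⟨⟨c, ?_⟩, fun i => ?_⟩
  · have h := D.abs_pow_le 1 x
    rw [pow_one] at h
    refine h.trans ((D.op_mono hc).trans_eq ?_)
    rw [map_smul, hfix]
  · obtain ⟨j, hj⟩ := D.exists_preadjoint i
    rw [hj]
    refine (hrec j).congr fun k => ?_
    rw [← hj, ← Module.End.mul_apply, ← Module.End.mul_apply, ← pow_succ, ← pow_succ']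

/-- The operator maps the recurrent vectors onto themselves. -/
theorem exists_op_eq (hfix : D.op u = u) (hU : IsIdempotentUltrafilter U) {x : X}
    (hx : x ∈ D.recurrent u U) : ∃ y ∈ D.recurrent u U, D.op y = x := by
  obtain ⟨⟨c, hc⟩, hrec⟩ := hx
  obtain ⟨y, hy, hlim⟩ := exists_mem_recurrent hfix hU hc le_rfl
  refine ⟨y, hy, D.ext_functional fun i _ => ?_⟩
  obtain ⟨j, hj⟩ := D.exists_preadjoint i
  refine tendsto_nhds_unique ?_ (hrec i)
  rw [hj]
  refine (hlim j).congr fun k => ?_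
  have hk : (k : ℕ) - 1 + 1 = k := Nat.sub_add_cancel k.pos
  rw [← hj, ← Module.End.mul_apply, ← pow_succ', hk]

/-- The operator reflects positivity of recurrent vectors. -/
theorem nonneg_of_op_nonneg {x : X} (hx : x ∈ D.recurrent u U) (h : 0 ≤ D.op x) : 0 ≤ x := by
  refine (D.nonneg_iff x).mpr fun i hi => ge_of_tendsto' (hx.2 i) fun k => ?_
  refine (D.nonneg_iff _).mp ?_ i hi
  have hk : (k : ℕ) - 1 + 1 = k := Nat.sub_add_cancel k.pos
  rw [← hk, pow_succ, Module.End.mul_apply]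
  exact D.pow_nonneg _ h

/-- Two recurrent vectors have a least upper bound among the recurrent vectors, namely the limit of
`T ^ k (x ⊔ y)`. -/
theorem exists_isLUB_recurrent (hfix : D.op u = u) (hU : IsIdempotentUltrafilter U)
    (x y : D.recurrent u U) : ∃ z : D.recurrent u U, IsLUB {x, y} z := by
  obtain ⟨x, ⟨c, hc⟩, hx⟩ := x
  obtain ⟨y, ⟨d, hd⟩, hy⟩ := y
  have hxy : |x ⊔ y| ≤ (c + d) • u := by
    have hc0 := (abs_nonneg x).trans hc
    have hd0 := (abs_nonneg y).trans hd
    rw [abs_le', add_smul]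
    refine ⟨sup_le ?_ ?_, ?_⟩
    · exact (le_abs_self x).trans (hc.trans (le_add_of_nonneg_right hd0))
    · exact (le_abs_self y).trans (hd.trans (le_add_of_nonneg_left hc0))
    · exact (neg_le_neg le_sup_left).trans
        ((neg_le_abs x).trans (hc.trans (le_add_of_nonneg_right hd0)))
  obtain ⟨z, hz, hlim⟩ := exists_mem_recurrent hfix hU hxy (Nat.zero_le 1)
  refine ⟨⟨z, hz⟩, ?_, ?_⟩
  · rintro w (rfl | rfl)
    · exact D.le_of_tendsto hx hlim fun k => D.pow_mono _ le_sup_left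
    · exact D.le_of_tendsto hy hlim fun k => D.pow_mono _ le_sup_right
  · rintro ⟨w, hw⟩ hwub
    have h1 : x ≤ w := hwub (Set.mem_insert _ _)
    have h2 : y ≤ w := hwub (Set.mem_insert_of_mem _ rfl)
    exact D.le_of_tendsto hlim hw.2 fun k => D.pow_mono _ (sup_le h1 h2)

/-- The lattice structure of the recurrent vectors. Its suprema are in general larger than those of
the ambient lattice. -/
noncomputable abbrev recurrentLattice (hfix : D.op u = u) (hU : IsIdempotentUltrafilter U) :
    Lattice (D.recurrent u U) :=
  let s : D.recurrent u U → D.recurrent u U → D.recurrent u U :=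
    fun x y => (exists_isLUB_recurrent hfix hU x y).choose
  have hs : ∀ x y, IsLUB {x, y} (s x y) := fun x y =>
    (exists_isLUB_recurrent hfix hU x y).choose_spec
  { (inferInstance : PartialOrder (D.recurrent u U)) with
    sup := s
    le_sup_left := fun x y => (hs x y).1 (Set.mem_insert _ _)
    le_sup_right := fun x y => (hs x y).1 (Set.mem_insert_of_mem _ rfl)
    sup_le := fun x y z hx hy => (hs x y).2 (by rintro w (rfl | rfl) <;> assumption)
    inf := fun x y => -s (-x) (-y)
    inf_le_left := fun x y => neg_le.mp ((hs (-x) (-y)).1 (Set.mem_insert _ _))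
    inf_le_right := fun x y => neg_le.mp ((hs (-x) (-y)).1 (Set.mem_insert_of_mem _ rfl))
    le_inf := fun x y z hx hy => le_neg.mp ((hs (-y) (-z)).2 (by
      rintro w (rfl | rfl)
      · exact neg_le_neg hx
      · exact neg_le_neg hy)) }

/-- The recurrent vectors are complete for the order unit norm of `u`. -/
theorem exists_limit_recurrent [CompleteSpace X] (hfix : D.op u = u)
    (hU : IsIdempotentUltrafilter U) (a : ℕ → D.recurrent u U)
    (ha : ∀ ε : ℝ, 0 < ε → ∃ N, ∀ m ≥ N, ∀ n ≥ N, (a m : X) - a n ≤ ε • u) :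
    ∃ x : D.recurrent u U, ∀ ε : ℝ, 0 < ε → ∃ N, ∀ n ≥ N,
      (a n : X) - x ≤ ε • u ∧ (x : X) - a n ≤ ε • u := by
  have hcauchy : CauchySeq fun n => (a n : X) := by
    rw [Metric.cauchySeq_iff]
    intro ε hε
    obtain ⟨N, hN⟩ := ha (ε / (‖u‖ + 1)) (by positivity)
    refine ⟨N, fun m hm n hn => ?_⟩
    have h : |(a m : X) - a n| ≤ (ε / (‖u‖ + 1)) • u :=
      abs_le'.mpr ⟨hN m hm n hn, by rw [neg_sub]; exact hN n hn m hm⟩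
    rw [dist_eq_norm]
    calc ‖(a m : X) - a n‖ ≤ ‖(ε / (‖u‖ + 1)) • u‖ :=
          norm_le_norm_of_abs_le_abs (h.trans (le_abs_self _))
      _ = ε / (‖u‖ + 1) * ‖u‖ := by rw [norm_smul, Real.norm_of_nonneg (by positivity)]
      _ < ε / (‖u‖ + 1) * (‖u‖ + 1) := by gcongr; linarith
      _ = ε := by field_simp
  obtain ⟨x, hx⟩ := cauchySeq_tendsto_of_complete hcauchy
  have hlim : ∀ ε : ℝ, 0 < ε → ∃ N, ∀ n ≥ N, (a n : X) - x ≤ ε • u ∧ x - a n ≤ ε • u := by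
    intro ε hε
    obtain ⟨N, hN⟩ := ha ε hε
    refine ⟨N, fun n hn => ⟨?_, ?_⟩⟩
    · exact le_of_tendsto' (b := ε • u)
        ((hx.comp (tendsto_add_atTop_nat N)).const_sub (a n : X))
        fun k => hN n hn (k + N) (Nat.le_add_left N k)
    · exact le_of_tendsto' (b := ε • u) ((hx.comp (tendsto_add_atTop_nat N)).sub_const (a n : X))
        fun k => hN (k + N) (Nat.le_add_left N k) n hn
  obtain ⟨c, hc⟩ : ∃ c : ℝ, |x| ≤ c • u := by
    obtain ⟨N, hN⟩ := hlim 1 one_pos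
    obtain ⟨h1, h2⟩ := hN N le_rfl
    obtain ⟨c, hc⟩ := (a N).2.1
    refine ⟨c + 1, ?_⟩
    have h3 : |x - a N| ≤ (1 : ℝ) • u := abs_le'.mpr ⟨h2, by rwa [neg_sub]⟩
    calc |x| = |a N + (x - a N)| := by rw [add_sub_cancel]
      _ ≤ |(a N : X)| + |x - a N| := abs_add_le _ _
      _ ≤ c • u + (1 : ℝ) • u := add_le_add hc h3
      _ = (c + 1) • u := (add_smul _ _ _).symm
  -- The norm limit `x` is replaced by the recurrent vector `lim T ^ k x`, to which the same
  -- estimates apply since `T ^ k (ε u) = ε u`.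
  obtain ⟨y, hy, hylim⟩ := exists_mem_recurrent hfix hU hc (Nat.zero_le 1)
  refine ⟨⟨y, hy⟩, fun ε hε => ?_⟩
  obtain ⟨N, hN⟩ := hlim ε hε
  have hpow : ∀ (k : ℕ) (v : X), v ≤ ε • u → (D.op ^ k) v ≤ ε • u := fun k v hv => by
    refine (D.pow_mono k hv).trans_eq ?_
    rw [map_smul, D.pow_fixed hfix]
  refine ⟨N, fun n hn => ⟨?_, ?_⟩⟩
  · refine D.le_of_tendsto (U := U) (a := fun k : ℕ+ => (D.op ^ ((k : ℕ) - 0)) (a n - x))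
      (fun i => ?_) (fun i => tendsto_const_nhds) fun k => hpow _ _ (hN n hn).1
    simp only [map_sub]
    exact ((a n).2.2 i).sub (hylim i)
  · refine D.le_of_tendsto (U := U) (a := fun k : ℕ+ => (D.op ^ ((k : ℕ) - 0)) (x - a n))
      (fun i => ?_) (fun i => tendsto_const_nhds) fun k => hpow _ _ (hN n hn).2
    simp only [map_sub]
    exact (hylim i).sub ((a n).2.2 i)

/-- The recurrent vectors form a space of functions on which the operator acts by composition with
a map `σ`, and which is closed under the continuous functional calculus. -/
theorem exists_representation [CompleteSpace X] (hu : 0 ≤ u) (hfix : D.op u = u)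
    (hU : IsIdempotentUltrafilter U) :
    ∃ (K : Type u) (σ : K → K) (e : D.recurrent u U →ₗ[ℝ] (K → ℝ)), Function.Injective e ∧
      (∀ x y : D.recurrent u U, (y : X) = D.op x → ∀ p, e y p = e x (σ p)) ∧
      ∀ F : ℝ → ℝ → ℝ, Continuous (Function.uncurry F) → ∀ x y : D.recurrent u U,
        ∃ z, ∀ p, e z p = F (e x p) (e y p) := by
  have hmem : u ∈ D.recurrent u U :=
    ⟨⟨1, by rw [one_smul, abs_of_nonneg hu]⟩, fun i => by
      simp only [D.pow_fixed hfix]; exact tendsto_const_nhds⟩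
  set u' : D.recurrent u U := ⟨u, hmem⟩ with hu'
  -- For `u = 0` the only recurrent vector is `0`, and `K` has to be empty.
  rcases hu.eq_or_lt with rfl | hpos
  · have hsub : ∀ x : D.recurrent 0 U, x = 0 := fun x => by
      obtain ⟨c, hc⟩ := x.2.1
      rw [smul_zero] at hc
      exact Subtype.ext (le_antisymm ((le_abs_self _).trans hc)
        (neg_nonpos.mp ((neg_le_abs _).trans hc)))
    exact ⟨PEmpty, id, 0, fun x y _ => (hsub x).trans (hsub y).symm, fun _ _ _ p => p.elim,
      fun _ _ _ _ => ⟨0, fun p => p.elim⟩⟩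
  let _ : Lattice (D.recurrent u U) := recurrentLattice hfix hU
  have : IsOrderedModule ℝ (D.recurrent u U) := IsOrderedModule.of_smul_nonneg
    fun t ht x hx => (smul_nonneg ht hx : (0 : X) ≤ t • (x : X))
  have hunit : OrderUnit.IsOrderUnit u' :=
    { pos := hpos
      dominates := fun x => by
        obtain ⟨c, hc⟩ := x.2.1
        exact ⟨c, (le_abs_self (x : X)).trans hc⟩
      archimedean := fun x hx => by
        change (x : X) ≤ 0
        refine D.le_iff.mpr fun i hi => ?_
        have h0 : Tendsto (fun ε : ℝ => ε * D.functional i u) (𝓝[>] 0) (𝓝 0) := by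
          have : Tendsto (fun ε : ℝ => ε * D.functional i u) (𝓝 0) (𝓝 (0 * D.functional i u)) :=
            tendsto_id.mul_const _
          rw [zero_mul] at this
          exact this.mono_left nhdsWithin_le_nhds
        rw [map_zero]
        refine ge_of_tendsto h0 (eventually_nhdsWithin_of_forall fun ε hε => ?_)
        have h : (x : X) ≤ ε • u := hx ε hε
        simpa using D.le_iff.mp h i hi }
  have hchar : ∀ φ : OrderUnit.Character u', OrderUnit.IsLatticeCharacter u'
      fun x => φ.1 ⟨D.op x, op_mem_recurrent hfix x.2⟩ := by
    intro φ
    refine ⟨fun x y => ?_, fun t x => ?_, fun x y => ?_, ?_⟩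
    · rw [← φ.2.map_add]
      exact congrArg φ.1 (Subtype.ext (map_add D.op (x : X) y))
    · rw [← φ.2.map_smul]
      exact congrArg φ.1 (Subtype.ext (map_smul D.op t (x : X)))
    · -- An order isomorphism preserves suprema.
      rw [← φ.2.map_sup]
      refine congrArg φ.1 (le_antisymm ?_ (sup_le ?_ ?_))
      · obtain ⟨w, hw, hwop⟩ := exists_op_eq hfix hU
          ((⟨D.op x, op_mem_recurrent hfix x.2⟩ ⊔ ⟨D.op y, op_mem_recurrent hfix y.2⟩ :
            D.recurrent u U)).2
        have key : ∀ v : D.recurrent u U, (⟨D.op v, op_mem_recurrent hfix v.2⟩ : D.recurrent u U) ≤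
            ⟨D.op x, op_mem_recurrent hfix x.2⟩ ⊔ ⟨D.op y, op_mem_recurrent hfix y.2⟩ →
            v ≤ ⟨w, hw⟩ := by
          intro v hv
          change (v : X) ≤ w
          rw [← sub_nonneg]
          refine nonneg_of_op_nonneg ((D.recurrent u U).sub_mem hw v.2) ?_
          rw [map_sub, hwop, sub_nonneg]
          exact hv
        have h : x ⊔ y ≤ ⟨w, hw⟩ := sup_le (key x le_sup_left) (key y le_sup_right)
        have h' : D.op (x ⊔ y : D.recurrent u U) ≤ D.op w := D.op_mono h
        rw [hwop] at h'
        exact h'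
      · exact D.op_mono (le_sup_left : x ≤ x ⊔ y)
      · exact D.op_mono (le_sup_right : y ≤ x ⊔ y)
    · rw [← φ.2.map_unit]
      exact congrArg φ.1 (Subtype.ext hfix)
  let e : D.recurrent u U →ₗ[ℝ] (OrderUnit.Character u' → ℝ) :=
    { toFun := fun x φ => φ.1 x
      map_add' := fun x y => funext fun φ => φ.2.map_add x y
      map_smul' := fun t x => funext fun φ => φ.2.map_smul t x }
  have hinj : Function.Injective e := fun x y h =>
    hunit.ext_character fun φ => congrFun h φ
  refine ⟨OrderUnit.Character u', fun φ => ⟨_, hchar φ⟩, e, hinj, fun x y h φ => ?_,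
    fun F hF x y => ?_⟩
  · exact congrArg φ.1 (Subtype.ext h)
  · obtain ⟨z, hz⟩ := hunit.eval_surjective
      (fun a ha => exists_limit_recurrent hfix hU a ha)
      ⟨fun φ => F (OrderUnit.eval u' x φ) (OrderUnit.eval u' y φ),
        hF.comp ((OrderUnit.eval u' x).continuous.prodMk (OrderUnit.eval u' y).continuous)⟩
    exact ⟨z, fun φ => DFunLike.congr_fun hz φ⟩

end PreadjointSystem

/-! ### Orbits of super-fixed vectors under (WS)-bounded operators -/

section WeightingScheme

open Filter Topology Complexification

theorem exists_ball_differentiableOn {f : ℂ → ℂ}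
    (hf : AnalyticOnNhd ℂ f (Metric.closedBall 0 1)) :
    ∃ r : ℝ, 1 < r ∧ DifferentiableOn ℂ f (Metric.ball 0 r) := by
  obtain ⟨δ, hδ, hsub⟩ := (isCompact_closedBall (0 : ℂ) 1).exists_thickening_subset_open
    (isOpen_analyticAt ℂ f) hf
  rw [thickening_closedBall hδ zero_le_one] at hsub
  exact ⟨δ + 1, by linarith, fun z hz => (hsub hz).differentiableAt.differentiableWithinAt⟩

theorem hasSum_taylorCoeff {f : ℂ → ℂ} {r : ℝ} (hf : DifferentiableOn ℂ f (Metric.ball 0 r))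
    {z : ℂ} (hz : ‖z‖ < r) : HasSum (fun k => taylorCoeff f k * z ^ k) (f z) := by
  have h := Complex.hasSum_taylorSeries_on_ball (c := 0) (z := z) hf (by simpa using hz)
  have e : (fun k => taylorCoeff f k * z ^ k) =
      fun k => (k.factorial : ℂ)⁻¹ • (z - 0) ^ k • iteratedDeriv k f 0 := funext fun k => by
    simp only [taylorCoeff, sub_zero, smul_eq_mul]
    ring
  rwa [e]

/-- The series `f(T)` converges absolutely: the coefficients of `f` decay geometrically, and the
norms `‖Tⁿ‖` grow subgeometrically by Gelfand's formula. -/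
theorem summable_analyticCalculus {E : Type*} [NormedAddCommGroup E] [NormedSpace ℂ E]
    [CompleteSpace E] {f : ℂ → ℂ} (hf : AnalyticOnNhd ℂ f (Metric.closedBall 0 1)) {T : E →L[ℂ] E}
    (hT : spectralRadius ℂ T = 1) : Summable fun k => taylorCoeff f k • T ^ k := by
  obtain ⟨r, hr, hfr⟩ := exists_ball_differentiableOn hf
  obtain ⟨s, hs1, hsr⟩ := exists_between hr
  have hs0 : 0 < s := one_pos.trans hs1
  have hsum := (hasSum_taylorCoeff hfr (z := (s : ℂ))
    (by rwa [Complex.norm_real, Real.norm_of_nonneg hs0.le])).summable.norm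
  refine Summable.of_norm_bounded_eventually_nat hsum ?_
  have hgelfand := spectrum.pow_norm_pow_one_div_tendsto_nhds_spectralRadius T
  rw [hT] at hgelfand
  have hev : ∀ᶠ n : ℕ in atTop, ENNReal.ofReal (‖T ^ n‖ ^ (1 / n : ℝ)) < ENNReal.ofReal s :=
    hgelfand.eventually_lt_const (by simpa using hs1)
  filter_upwards [hev, eventually_gt_atTop 0] with n hn hn0
  rw [ENNReal.ofReal_lt_ofReal_iff hs0] at hn
  have hTn : ‖T ^ n‖ ≤ s ^ n := by
    have h := pow_le_pow_left₀ (by positivity) hn.le n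
    rwa [one_div, Real.rpow_inv_natCast_pow (norm_nonneg _) hn0.ne'] at h
  have hsn : ‖(s : ℂ) ^ n‖ = s ^ n := by
    rw [norm_pow, Complex.norm_real, Real.norm_of_nonneg hs0.le]
  rw [norm_smul, norm_mul, hsn]
  gcongr

theorem IsWeightingScheme.coeff_nonneg {J : Type*} [Preorder J] [IsDirectedOrder J] [Nonempty J]
    {f : J → ℂ → ℂ} (hf : IsWeightingScheme f) (j : J) (k : ℕ) :
    0 ≤ (taylorCoeff (f j) k).re := by
  rw [taylorCoeff, Complex.div_natCast_re]
  exact div_nonneg (hf.deriv_nonneg j k).2 (Nat.cast_nonneg _)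

theorem IsWeightingScheme.coeff_im {J : Type*} [Preorder J] [IsDirectedOrder J] [Nonempty J]
    {f : J → ℂ → ℂ} (hf : IsWeightingScheme f) (j : J) (k : ℕ) :
    (taylorCoeff (f j) k).im = 0 := by
  rw [taylorCoeff, Complex.div_natCast_im, (hf.deriv_nonneg j k).1, zero_div]

theorem IsWeightingScheme.hasSum_coeff {J : Type*} [Preorder J] [IsDirectedOrder J] [Nonempty J]
    {f : J → ℂ → ℂ} (hf : IsWeightingScheme f) (j : J) :
    HasSum (fun k => (taylorCoeff (f j) k).re) 1 := by
  obtain ⟨r, hr, hfr⟩ := exists_ball_differentiableOn (hf.analytic j)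
  have h := Complex.hasSum_re (hasSum_taylorCoeff hfr (z := 1) (by simpa using hr))
  simpa [hf.map_one j] using h

/-- The coefficients of a weighting scheme tend to zero, since `a_k 2⁻ᵏ ≤ f (1 / 2)`. -/
theorem IsWeightingScheme.tendsto_coeff {J : Type*} [Preorder J] [IsDirectedOrder J] [Nonempty J]
    {f : J → ℂ → ℂ} (hf : IsWeightingScheme f) (k : ℕ) :
    Tendsto (fun j => (taylorCoeff (f j) k).re) atTop (𝓝 0) := by
  have hlim : Tendsto (fun j => 2 ^ k * (f j (1 / 2)).re) atTop (𝓝 0) := by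
    have h := (Complex.continuous_re.tendsto _).comp (hf.tendsto_zero (1 / 2) (by norm_num))
    simpa using h.const_mul ((2 : ℝ) ^ k)
  refine squeeze_zero (fun j => hf.coeff_nonneg j k) (fun j => ?_) hlim
  obtain ⟨r, hr, hfr⟩ := exists_ball_differentiableOn (hf.analytic j)
  have hsum := hasSum_taylorCoeff hfr (z := 1 / 2) (by norm_num; linarith)
  have hsum' := Complex.hasSum_re hsum
  have e : ∀ k, (taylorCoeff (f j) k * (1 / 2) ^ k).re =
      (taylorCoeff (f j) k).re * (1 / 2) ^ k := fun k => by
    have : ((1 / 2 : ℂ)) ^ k = (((1 / 2 : ℝ) ^ k : ℝ) : ℂ) := by push_cast; rfl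
    rw [this, Complex.re_mul_ofReal]
  simp only [e] at hsum'
  have h := le_hasSum hsum' k fun i _ => mul_nonneg (hf.coeff_nonneg j i) (by positivity)
  calc (taylorCoeff (f j) k).re
      = 2 ^ k * ((taylorCoeff (f j) k).re * (1 / 2) ^ k) := by
        rw [mul_left_comm, ← mul_pow]; norm_num
    _ ≤ 2 ^ k * (f j (1 / 2)).re := by gcongr

variable {X I : Type*} [NormedAddCommGroup X] [NormedSpace ℝ X] [Lattice X]
  [IsOrderedAddMonoid X] [IsOrderedModule ℝ X] [HasSolidNorm X]

/-- Since the orbit of `x ≤ T x` increases, a convex series in `T` applied to `x` dominates the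
`n`-th vector of the orbit up to the mass of the first `n` coefficients. -/
theorem PreadjointSystem.smul_pow_le_of_hasSum (D : PreadjointSystem X I) {x y : X} (hx0 : 0 ≤ x)
    (hx : x ≤ D.op x) {α : ℕ → ℝ} (hα : ∀ k, 0 ≤ α k) (hsum : HasSum α 1)
    (hy : HasSum (fun k => α k • (D.op ^ k) x) y) (n : ℕ) :
    (1 - ∑ k ∈ Finset.range n, α k) • (D.op ^ n) x ≤ y := by
  have hmono : Monotone fun n => (D.op ^ n) x := monotone_nat_of_le_succ fun n => by
    rw [pow_succ, Module.End.mul_apply]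
    exact D.pow_mono n hx
  have h1 := (hasSum_nat_add_iff' n).mpr hsum
  have h2 := (hasSum_nat_add_iff' n).mpr hy
  have h3 := hasSum_le (fun k => smul_le_smul_of_nonneg_left (hmono (Nat.le_add_left n k))
    (hα (k + n))) (h1.smul_const ((D.op ^ n) x)) h2
  refine h3.trans (sub_le_self _ (Finset.sum_nonneg fun k _ => ?_))
  exact smul_nonneg (hα k) (D.pow_nonneg k hx0)

/-- Under a (WS)-bounded positive operator the orbit of `0 ≤ x ≤ T x` is bounded. -/
theorem PreadjointSystem.exists_norm_pow_le [CompleteSpace X] (D : PreadjointSystem X I)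
    {T : Complexification X →L[ℂ] Complexification X}
    (hT : ∀ x : X, T ⟨x, 0⟩ = ⟨D.op x, 0⟩) (hr : spectralRadius ℂ T = 1)
    (hws : IsWSBounded T) {x : X} (hx0 : 0 ≤ x) (hx : x ≤ D.op x) :
    ∃ C, ∀ n, ‖(D.op ^ n) x‖ ≤ C := by
  obtain ⟨J, _, _, _, f, hf, C, hC⟩ := hws
  have hTn : ∀ n, (T ^ n) ⟨x, 0⟩ = ⟨(D.op ^ n) x, 0⟩ := by
    intro n
    induction n with
    | zero => rfl
    | succ n ih =>
      rw [pow_succ', mul_apply_eq_comp, ih, hT, pow_succ', Module.End.mul_apply]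
  let reL : Complexification X →+ X :=
    { toFun := Complexification.re, map_zero' := rfl, map_add' := fun _ _ => rfl }
  have hre : Continuous reL := AddMonoidHomClass.continuous_of_bound reL 1 fun z => by
    rw [one_mul]; exact norm_re_le z
  have hsum : ∀ j, HasSum (fun k => (taylorCoeff (f j) k).re • (D.op ^ k) x)
      (analyticCalculus (f j) T ⟨x, 0⟩).re := by
    intro j
    have h1 := (summable_analyticCalculus (hf.analytic j) hr).hasSum
    have h2 := (h1.mapL (ContinuousLinearMap.apply ℂ (Complexification X) ⟨x, 0⟩)).map reL hre
    have e : (fun k => (taylorCoeff (f j) k).re • (D.op ^ k) x) = reL ∘ fun k =>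
        ContinuousLinearMap.apply ℂ (Complexification X) ⟨x, 0⟩ (taylorCoeff (f j) k • T ^ k) := by
      funext k
      change _ = (taylorCoeff (f j) k • (T ^ k) ⟨x, 0⟩).re
      rw [hTn, smul_re, hf.coeff_im, zero_smul, sub_zero]
    rw [e]
    exact h2
  refine ⟨C * ‖(⟨x, 0⟩ : Complexification X)‖, fun n => ?_⟩
  have hle : ∀ j, ‖(1 - ∑ k ∈ Finset.range n, (taylorCoeff (f j) k).re) • (D.op ^ n) x‖ ≤
      C * ‖(⟨x, 0⟩ : Complexification X)‖ := by
    intro j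
    have h1 := D.smul_pow_le_of_hasSum hx0 hx (hf.coeff_nonneg j) (hf.hasSum_coeff j) (hsum j) n
    have h0 : 0 ≤ 1 - ∑ k ∈ Finset.range n, (taylorCoeff (f j) k).re :=
      sub_nonneg.mpr (sum_le_hasSum _ (fun k _ => hf.coeff_nonneg j k) (hf.hasSum_coeff j))
    calc _ ≤ ‖(analyticCalculus (f j) T ⟨x, 0⟩).re‖ :=
          norm_le_norm_of_nonneg_of_le (smul_nonneg h0 (D.pow_nonneg n hx0)) h1
      _ ≤ ‖analyticCalculus (f j) T ⟨x, 0⟩‖ := norm_re_le _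
      _ ≤ C * ‖(⟨x, 0⟩ : Complexification X)‖ := ContinuousLinearMap.le_of_opNorm_le _ (hC j) _
  have hlim : Tendsto (fun j => ‖(1 - ∑ k ∈ Finset.range n, (taylorCoeff (f j) k).re) •
      (D.op ^ n) x‖) atTop (𝓝 ‖(D.op ^ n) x‖) := by
    have h1 : Tendsto (fun j => 1 - ∑ k ∈ Finset.range n, (taylorCoeff (f j) k).re) atTop
        (𝓝 (1 - ∑ k ∈ Finset.range n, (0 : ℝ))) :=
      (tendsto_finsetSum _ fun k _ => hf.tendsto_coeff k).const_sub 1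
    have h2 := (h1.smul_const ((D.op ^ n) x)).norm
    simpa using h2
  exact le_of_tendsto' hlim hle

end WeightingScheme

/-! ### Restriction to the real parts -/

section Realification

open Filter Topology Complexification

variable {X Y : Type*}
  [NormedAddCommGroup X] [NormedSpace ℝ X] [CompleteSpace X] [Lattice X]
  [IsOrderedAddMonoid X] [IsOrderedModule ℝ X] [HasSolidNorm X]
  [NormedAddCommGroup Y] [NormedSpace ℝ Y] [CompleteSpace Y] [Lattice Y]
  [IsOrderedAddMonoid Y] [IsOrderedModule ℝ Y] [HasSolidNorm Y]

theorem Complexification.eq_re_add_I_smul_im (z : Complexification X) :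
    z = ⟨z.re, 0⟩ + Complex.I • ⟨z.im, 0⟩ := by
  ext <;> simp

theorem Complexification.mk_eq_posPart_sub_negPart (x : X) :
    (⟨x, 0⟩ : Complexification X) = ⟨x⁺, 0⟩ - ⟨x⁻, 0⟩ := by
  ext <;> simp [posPart_sub_negPart]

theorem Complexification.mk_smul (t : ℝ) (x : X) :
    (⟨t • x, 0⟩ : Complexification X) = (t : ℂ) • ⟨x, 0⟩ := by
  ext <;> simp only [smul_re, smul_im, Complex.ofReal_re, Complex.ofReal_im] <;> simp

theorem Complexification.mk_add (x y : X) :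
    (⟨x + y, 0⟩ : Complexification X) = ⟨x, 0⟩ + ⟨y, 0⟩ := by
  ext <;> simp

theorem Complexification.norm_mk_le (x : X) : ‖(⟨x, 0⟩ : Complexification X)‖ ≤ ‖x‖ := by
  simpa using norm_le_re_add_im (⟨x, 0⟩ : Complexification X)

/-- The restriction of an operator on the complexification to the real part. -/
noncomputable def realRestrict (T : Complexification X →L[ℂ] Complexification X) : X →ₗ[ℝ] X where
  toFun x := (T ⟨x, 0⟩).re
  map_add' x y := by rw [mk_add, map_add, add_re]
  map_smul' t x := by
    rw [mk_smul, map_smul, smul_re, Complex.ofReal_re, Complex.ofReal_im, zero_smul, sub_zero,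
      RingHom.id_apply]

theorem IsPositiveOperator.apply_mk {T : Complexification X →L[ℂ] Complexification X}
    (hT : IsPositiveOperator T) (x : X) : T ⟨x, 0⟩ = ⟨realRestrict T x, 0⟩ := by
  refine Complexification.ext rfl ?_
  rw [mk_eq_posPart_sub_negPart, map_sub, sub_im, (hT ⟨x⁺, 0⟩ ⟨rfl, posPart_nonneg x⟩).1,
    (hT ⟨x⁻, 0⟩ ⟨rfl, negPart_nonneg x⟩).1, sub_zero]

theorem IsPositiveOperator.apply_eq {T : Complexification X →L[ℂ] Complexification X}
    (hT : IsPositiveOperator T) (z : Complexification X) :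
    T z = ⟨realRestrict T z.re, realRestrict T z.im⟩ := by
  conv_lhs => rw [eq_re_add_I_smul_im z, map_add, map_smul, hT.apply_mk, hT.apply_mk]
  ext <;> simp

namespace PredualBanachLattice

variable (D : PredualBanachLattice X Y)

/-- The real functional on `X` given by an element of the pre-dual. -/
noncomputable def realFunctional (f : Complexification Y) : X →ₗ[ℝ] ℝ where
  toFun x := (D.toDual ⟨x, 0⟩ f).re
  map_add' x y := by rw [mk_add, map_add, add_apply, Complex.add_re]
  map_smul' t x := by
    rw [mk_smul, map_smul, smul_apply, smul_eq_mul, Complex.re_ofReal_mul, RingHom.id_apply,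
      smul_eq_mul]

theorem toDual_mk_im {f : Complexification Y} (hf : f.IsPos) (x : X) :
    (D.toDual ⟨x, 0⟩ f).im = 0 := by
  rw [mk_eq_posPart_sub_negPart, map_sub, sub_apply, Complex.sub_im,
    ((D.isPos_iff ⟨x⁺, 0⟩).mp ⟨rfl, posPart_nonneg x⟩ f hf).1,
    ((D.isPos_iff ⟨x⁻, 0⟩).mp ⟨rfl, negPart_nonneg x⟩ f hf).1, sub_zero]

theorem nonneg_iff (x : X) : 0 ≤ x ↔ ∀ f : Complexification Y, f.IsPos →
    0 ≤ D.realFunctional f x := by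
  have h : (⟨x, 0⟩ : Complexification X).IsPos ↔ 0 ≤ x := ⟨fun h => h.2, fun h => ⟨rfl, h⟩⟩
  rw [← h, D.isPos_iff]
  exact ⟨fun h f hf => (h f hf).2, fun h f hf => ⟨D.toDual_mk_im hf x, h f hf⟩⟩

/-- Banach–Alaoglu: bounded families in `X` have weak-star ultralimits. -/
theorem exists_limit {J : Type} (U : Ultrafilter J) (a : J → X) (C : ℝ) (ha : ∀ j, ‖a j‖ ≤ C) :
    ∃ y, ∀ f, Tendsto (fun j => D.realFunctional f (a j)) U (𝓝 (D.realFunctional f y)) := by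
  obtain ⟨ψ, -, hψ⟩ := (WeakDual.isCompact_closedBall
    (0 : StrongDual ℂ (Complexification Y)) C).ultrafilter_le_nhds
    (U.map fun j => StrongDual.toWeakDual (D.toDual ⟨a j, 0⟩)) (by
      rw [Ultrafilter.coe_map, le_principal_iff, mem_map]
      refine univ_mem' fun j => ?_
      rw [Set.mem_preimage, Set.mem_preimage, mem_closedBall_zero_iff]
      exact (D.toDual.norm_map ⟨a j, 0⟩).trans_le ((norm_mk_le _).trans (ha j)))
  have hlim : ∀ f, Tendsto (fun j => D.toDual ⟨a j, 0⟩ f) U (𝓝 (ψ f)) := fun f =>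
    ((WeakDual.eval_continuous f).tendsto ψ).comp hψ
  obtain ⟨z, hz⟩ := D.toDual.surjective (WeakDual.toStrongDual ψ)
  have hz' : ∀ f, D.toDual z f = ψ f := fun f => by rw [hz]; rfl
  have hsplit : ∀ f, D.toDual z f = D.toDual ⟨z.re, 0⟩ f + Complex.I * D.toDual ⟨z.im, 0⟩ f := by
    intro f
    conv_lhs => rw [eq_re_add_I_smul_im z, map_add, map_smul]
    rfl
  -- Limits of real functionals are real, so the limit vector has no imaginary part.
  have him0 : ∀ f : Complexification Y, f.IsPos → D.realFunctional f z.im = 0 := by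
    intro f hf
    have h1 : (D.toDual z f).im = 0 := by
      rw [hz']
      refine tendsto_nhds_unique ((Complex.continuous_im.tendsto _).comp (hlim f)) ?_
      exact tendsto_const_nhds.congr fun j => (D.toDual_mk_im hf (a j)).symm
    rw [hsplit, Complex.add_im, D.toDual_mk_im hf, zero_add, Complex.I_mul_im] at h1
    exact h1
  have hzim : z.im = 0 := by
    refine le_antisymm ?_ ((D.nonneg_iff _).mpr fun f hf => (him0 f hf).ge)
    rw [← neg_nonneg, D.nonneg_iff]
    intro f hf
    rw [map_neg, him0 f hf, neg_zero]
  have hzre : (⟨z.re, 0⟩ : Complexification X) = z := Complexification.ext rfl hzim.symm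
  refine ⟨z.re, fun f => ?_⟩
  change Tendsto _ _ (𝓝 (D.toDual ⟨z.re, 0⟩ f).re)
  rw [hzre, hz']
  exact (Complex.continuous_re.tendsto _).comp (hlim f)

/-- The real system of a positive operator with pre-adjoint. -/
noncomputable def system {T : Complexification X →L[ℂ] Complexification X}
    (hT : IsPositiveOperator T) (hpre : HasPreadjoint D T) :
    PreadjointSystem X (Complexification Y) where
  functional := D.realFunctional
  cone := {f | f.IsPos}
  nonneg_iff := D.nonneg_iff
  exists_limit := D.exists_limit
  op := realRestrict T
  op_nonneg x hx := (hT ⟨x, 0⟩ ⟨rfl, hx⟩).2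
  exists_preadjoint f := by
    obtain ⟨S, hS⟩ := hpre
    refine ⟨S f, fun x => ?_⟩
    change (D.toDual ⟨realRestrict T x, 0⟩ f).re = (D.toDual ⟨x, 0⟩ (S f)).re
    rw [← hT.apply_mk, hS]
    rfl

end PredualBanachLattice

end Realification

/-! ### The complex space of recurrent vectors -/

section ComplexRepresentation

open Filter Topology Complexification

variable {X : Type u} {I : Type v} [NormedAddCommGroup X] [NormedSpace ℝ X] [Lattice X]
  [IsOrderedAddMonoid X] [IsOrderedModule ℝ X] [HasSolidNorm X] [CompleteSpace X]
  {D : PreadjointSystem X I} {T : Complexification X →L[ℂ] Complexification X}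

theorem PreadjointSystem.modulus_apply_le (hT : ∀ z, T z = ⟨D.op z.re, D.op z.im⟩)
    (z : Complexification X) : modulus (T z) ≤ D.op (modulus z) := by
  refine modulus_le fun θ => ?_
  have e : rot (T z) θ = D.op (rot z θ) := by
    rw [hT]
    simp [rot]
  rw [e]
  exact D.op_mono (rot_le_modulus z θ)

theorem PreadjointSystem.modulus_le_op_modulus (hT : ∀ z, T z = ⟨D.op z.re, D.op z.im⟩) {μ : ℂ}
    (hμ : ‖μ‖ = 1) {z : Complexification X} (hz : T z = μ • z) :
    modulus z ≤ D.op (modulus z) := by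
  refine le_trans ?_ (PreadjointSystem.modulus_apply_le hT z)
  have hμ0 : μ ≠ 0 := by rintro rfl; simp at hμ
  have h := modulus_smul_le μ⁻¹ (μ • z)
  rwa [inv_smul_smul₀ hμ0, norm_inv, hμ, inv_one, one_smul, ← hz] at h

/-- The peripheral eigenvectors with modulus at most `u` are recurrent, because powers of their
eigenvalue tend to `1` along an idempotent ultrafilter. -/
theorem PreadjointSystem.mem_recurrent_of_eigenvector (hT : ∀ z, T z = ⟨D.op z.re, D.op z.im⟩)
    {u : X} {U : Ultrafilter ℕ+} (hU : IsIdempotentUltrafilter U) {μ : ℂ} (hμ : ‖μ‖ = 1)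
    {z : Complexification X} (hz : T z = μ • z) (hzu : modulus z ≤ u) :
    z.re ∈ D.recurrent u U ∧ z.im ∈ D.recurrent u U := by
  have hpow : ∀ n : ℕ, (⟨(D.op ^ n) z.re, (D.op ^ n) z.im⟩ : Complexification X) = μ ^ n • z := by
    intro n
    induction n with
    | zero => simp
    | succ n ih =>
      rw [pow_succ μ n, mul_smul, ← hz, ← (T.map_smul (μ ^ n) z), ← ih, hT, pow_succ']
      rfl
  have hre : ∀ n : ℕ, (D.op ^ n) z.re = (μ ^ n).re • z.re - (μ ^ n).im • z.im := fun n =>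
    congrArg Complexification.re (hpow n)
  have him : ∀ n : ℕ, (D.op ^ n) z.im = (μ ^ n).re • z.im + (μ ^ n).im • z.re := fun n =>
    congrArg Complexification.im (hpow n)
  have h1 : Tendsto (fun k : ℕ+ => (μ ^ (k : ℕ)).re) U (𝓝 1) :=
    (Complex.continuous_re.tendsto 1).comp (hU.tendsto_pow hμ)
  have h0 : Tendsto (fun k : ℕ+ => (μ ^ (k : ℕ)).im) U (𝓝 0) :=
    (Complex.continuous_im.tendsto 1).comp (hU.tendsto_pow hμ)
  refine ⟨⟨⟨1, ?_⟩, fun i => ?_⟩, ⟨⟨1, ?_⟩, fun i => ?_⟩⟩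
  · rw [one_smul]
    exact (abs_re_le_modulus z).trans hzu
  · simp only [hre, map_sub, map_smul, smul_eq_mul]
    simpa using (h1.mul_const (D.functional i z.re)).sub (h0.mul_const (D.functional i z.im))
  · rw [one_smul]
    exact (abs_im_le_modulus z).trans hzu
  · simp only [him, map_add, map_smul, smul_eq_mul]
    simpa using (h1.mul_const (D.functional i z.im)).add (h0.mul_const (D.functional i z.re))

/-- The peripheral eigenvectors dominated by a fixed vector lie in a space of complex functions on
which the operator acts by composition with a map `σ`, and which is closed under continuous
functions of one complex variable. -/
theorem PreadjointSystem.exists_complex_representation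
    (hT : ∀ z, T z = ⟨D.op z.re, D.op z.im⟩) {u : X} (hu : 0 ≤ u) (hfix : D.op u = u) :
    ∃ (K : Type u) (σ : K → K) (V : Submodule ℂ (Complexification X)) (e : V →ₗ[ℂ] (K → ℂ)),
      Function.Injective e ∧
      (∀ z : V, ∃ hz : T z ∈ V, ∀ p, e ⟨T z, hz⟩ p = e z (σ p)) ∧
      (∀ F : ℂ → ℂ, Continuous F → ∀ z, ∃ w, ∀ p, e w p = F (e z p)) ∧
      ∀ (μ : ℂ) (z : Complexification X), ‖μ‖ = 1 → T z = μ • z → modulus z ≤ u → z ∈ V := by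
  obtain ⟨U, hU⟩ := exists_isIdempotentUltrafilter
  obtain ⟨K, σ, e, hinj, hσ, hF⟩ := D.exists_representation hu hfix hU
  let V : Submodule ℂ (Complexification X) :=
    { carrier := {z | z.re ∈ D.recurrent u U ∧ z.im ∈ D.recurrent u U}
      add_mem' := fun hz hw => ⟨add_mem hz.1 hw.1, add_mem hz.2 hw.2⟩
      zero_mem' := ⟨zero_mem _, zero_mem _⟩
      smul_mem' := fun c z hz =>
        ⟨sub_mem (Submodule.smul_mem _ _ hz.1) (Submodule.smul_mem _ _ hz.2),
          add_mem (Submodule.smul_mem _ _ hz.2) (Submodule.smul_mem _ _ hz.1)⟩ }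
  let re' : V → D.recurrent u U := fun z => ⟨z.1.re, z.2.1⟩
  let im' : V → D.recurrent u U := fun z => ⟨z.1.im, z.2.2⟩
  let E : V →ₗ[ℂ] (K → ℂ) :=
    { toFun := fun z p => ⟨e (re' z) p, e (im' z) p⟩
      map_add' := fun z w => funext fun p => by
        have h1 : re' (z + w) = re' z + re' w := rfl
        have h2 : im' (z + w) = im' z + im' w := rfl
        rw [h1, h2, map_add, map_add]
        rfl
      map_smul' := fun c z => funext fun p => by
        have h1 : re' (c • z) = c.re • re' z - c.im • im' z := rfl
        have h2 : im' (c • z) = c.re • im' z + c.im • re' z := rfl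
        rw [h1, h2, map_sub, map_add, map_smul, map_smul, map_smul, map_smul]
        rfl }
  have hinjE : Function.Injective E := by
    intro z w h
    have h1 : re' z = re' w := hinj (funext fun p => congrArg Complex.re (congrFun h p))
    have h2 : im' z = im' w := hinj (funext fun p => congrArg Complex.im (congrFun h p))
    exact Subtype.ext (Complexification.ext (congrArg Subtype.val h1) (congrArg Subtype.val h2))
  refine ⟨K, σ, V, E, hinjE, fun z => ?_, fun F hFc z => ?_, fun μ z hμ hz hzu =>
    PreadjointSystem.mem_recurrent_of_eigenvector hT hU hμ hz hzu⟩
  · have hmem : T z ∈ V := by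
      rw [hT]
      exact ⟨PreadjointSystem.op_mem_recurrent hfix z.2.1,
        PreadjointSystem.op_mem_recurrent hfix z.2.2⟩
    refine ⟨hmem, fun p => Complex.ext ?_ ?_⟩
    · exact hσ (re' z) (re' ⟨T z, hmem⟩) (congrArg Complexification.re (hT z)) p
    · exact hσ (im' z) (im' ⟨T z, hmem⟩) (congrArg Complexification.im (hT z)) p
  · have hmk : Continuous fun q : ℝ × ℝ => F (Complex.mk q.1 q.2) := by
      refine hFc.comp ?_
      exact Complex.equivRealProdCLM.symm.continuous
    obtain ⟨a, ha⟩ := hF (fun s t => (F ⟨s, t⟩).re) (Complex.continuous_re.comp hmk) (re' z) (im' z)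
    obtain ⟨b, hb⟩ := hF (fun s t => (F ⟨s, t⟩).im) (Complex.continuous_im.comp hmk) (re' z) (im' z)
    exact ⟨⟨⟨a, b⟩, a.2, b.2⟩, fun p => Complex.ext (ha p) (hb p)⟩

end ComplexRepresentation

/-! ### Powers of eigenfunctions -/

/-- A continuous substitute for the power `ζ ↦ ζ ^ n` with integer exponent: it has modulus
`|ζ| ^ (|n| + 1)` and the phase of `ζ ^ n`, so that it vanishes only at `0`. -/
noncomputable def phasePow (n : ℤ) (ζ : ℂ) : ℂ :=
  ζ ^ n.toNat * (starRingEnd ℂ ζ) ^ (-n).toNat * (‖ζ‖ : ℂ)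

theorem continuous_phasePow (n : ℤ) : Continuous (phasePow n) := by
  unfold phasePow
  fun_prop

theorem phasePow_zero (n : ℤ) : phasePow n 0 = 0 := by simp [phasePow]

theorem phasePow_one (n : ℤ) : phasePow n 1 = 1 := by simp [phasePow]

theorem phasePow_mul {μ : ℂ} (hμ : ‖μ‖ = 1) (n : ℤ) (ζ : ℂ) :
    phasePow n (μ * ζ) = μ ^ n * phasePow n ζ := by
  have hconj : starRingEnd ℂ μ = μ⁻¹ := (Complex.inv_eq_conj hμ).symm
  have hμ0 : μ ≠ 0 := by rintro rfl; simp at hμ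
  have hn : μ ^ n.toNat * (μ⁻¹) ^ (-n).toNat = μ ^ n := by
    rw [← zpow_natCast μ n.toNat, ← zpow_natCast μ⁻¹, inv_zpow', ← zpow_add₀ hμ0]
    congr 1
    omega
  rw [phasePow, phasePow, map_mul, hconj, norm_mul, hμ, one_mul, mul_pow, mul_pow, ← hn]
  ring

/-- Linearly independent functions have combinations that form a dual system to evaluations at
suitable points. -/
theorem exists_dual_points {K : Type*} {m : ℕ} {v : Fin m → K → ℂ} (hv : LinearIndependent ℂ v) :
    ∃ (p : Fin m → K) (A : Fin m → Fin m → ℂ),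
      ∀ i k, ∑ j, A i j * v j (p k) = if i = k then 1 else 0 := by
  let F : K → Fin m → ℂ := fun q j => v j q
  have hspan : Submodule.span ℂ (Set.range F) = ⊤ := by
    by_contra hne
    obtain ⟨f, hf0, hf⟩ := Submodule.exists_le_ker_of_lt_top _ (lt_top_iff_ne_top.mpr hne)
    refine hf0 ?_
    have hsum : ∑ j, f (Pi.single j 1) • v j = 0 := by
      funext q
      have h : f (F q) = 0 := hf (Submodule.subset_span ⟨q, rfl⟩)
      rw [LinearMap.pi_apply_eq_sum_univ f (F q)] at h
      rw [Finset.sum_apply, Pi.zero_apply, ← h]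
      refine Finset.sum_congr rfl fun j _ => ?_
      rw [Pi.smul_apply, smul_eq_mul, smul_eq_mul, mul_comm]
      congr 2
      funext k
      simp [Pi.single_apply, eq_comm]
    have hzero := Fintype.linearIndependent_iff.mp hv _ hsum
    exact LinearMap.pi_ext' fun j => LinearMap.ext_ring (hzero j)
  obtain ⟨κ, a, -, hsp, hli⟩ := exists_linearIndependent' ℂ F
  obtain ⟨p, c, hc⟩ : ∃ (p : Fin m → K) (c : Module.Basis (Fin m) ℂ (Fin m → ℂ)),
      ∀ k, c k = F (p k) := by
    obtain ⟨b, hb⟩ : ∃ b : Module.Basis κ ℂ (Fin m → ℂ), ∀ k, b k = F (a k) :=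
      ⟨Module.Basis.mk hli (by rw [hsp, hspan]), fun k => Module.Basis.mk_apply hli _ k⟩
    let r := b.indexEquiv (Pi.basisFun ℂ (Fin m))
    exact ⟨fun k => a (r.symm k), b.reindex r, fun k => by rw [Module.Basis.reindex_apply, hb]⟩
  refine ⟨p, fun i j => c.coord i (Pi.single j 1), fun i k => ?_⟩
  have h : c.coord i (c k) = if i = k then 1 else 0 := by
    rw [Module.Basis.coord_apply, Module.Basis.repr_self, Finsupp.single_apply]
    simp only [eq_comm]
  rw [← h, hc, LinearMap.pi_apply_eq_sum_univ (c.coord i)]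
  refine Finset.sum_congr rfl fun j _ => ?_
  rw [smul_eq_mul, mul_comm]
  refine congrArg (_ * ·) (congrArg (c.coord i) (funext fun k => ?_))
  simp [Pi.single_apply, eq_comm]

/-! ### Dimensions of peripheral eigenspaces -/

section EigenspaceDimension

open Complexification

variable {X : Type u} {Y : Type v}
  [NormedAddCommGroup X] [NormedSpace ℝ X] [CompleteSpace X] [Lattice X]
  [IsOrderedAddMonoid X] [IsOrderedModule ℝ X] [HasSolidNorm X]
  [NormedAddCommGroup Y] [NormedSpace ℝ Y] [CompleteSpace Y] [Lattice Y]
  [IsOrderedAddMonoid Y] [IsOrderedModule ℝ Y] [HasSolidNorm Y]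

/-- Every peripheral eigenvector is dominated by a positive fixed vector. -/
theorem PreadjointSystem.exists_fixed_ge_modulus {I : Type*} {D : PreadjointSystem X I}
    {T : Complexification X →L[ℂ] Complexification X} (hT : ∀ z, T z = ⟨D.op z.re, D.op z.im⟩)
    (hr : spectralRadius ℂ T = 1) (hws : IsWSBounded.{u, w} T) {μ : ℂ} (hμ : ‖μ‖ = 1)
    {z : Complexification X} (hz : T z = μ • z) : ∃ u, modulus z ≤ u ∧ D.op u = u := by
  have hle := PreadjointSystem.modulus_le_op_modulus hT hμ hz
  obtain ⟨C, hC⟩ := D.exists_norm_pow_le (fun x => by rw [hT, map_zero]) hr hws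
    (modulus_nonneg z) hle
  exact D.exists_fixed_ge hle hC

theorem mem_ker_iff {T : Complexification X →L[ℂ] Complexification X} {μ : ℂ}
    {z : Complexification X} :
    z ∈ LinearMap.ker ((μ • ContinuousLinearMap.id ℂ (Complexification X) - T :
      Complexification X →L[ℂ] Complexification X) :
        Complexification X →ₗ[ℂ] Complexification X) ↔ T z = μ • z := by
  rw [LinearMap.mem_ker]
  change μ • z - T z = 0 ↔ _
  rw [sub_eq_zero, eq_comm]

/-- The dimension estimate. Infinite dimension is covered by comparing finite linearly independent
families, so that finitely many eigenvectors are treated at a time. -/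
theorem PreadjointSystem.kerDim_le_kerDim_zpow {I : Type*} {D : PreadjointSystem X I}
    {T : Complexification X →L[ℂ] Complexification X} (hT : ∀ z, T z = ⟨D.op z.re, D.op z.im⟩)
    (hr : spectralRadius ℂ T = 1) (hws : IsWSBounded.{u, w} T) {μ : ℂ} (hμ : ‖μ‖ = 1) (n : ℤ) :
    kerDim μ T ≤ kerDim (μ ^ n) T := by
  refine ENat.forall_natCast_le_iff_le.mp fun m hm => ?_
  rw [kerDim, Cardinal.natCast_le_toENat, Module.le_rank_iff] at hm ⊢
  obtain ⟨v, hv⟩ := hm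
  have hvT : ∀ j, T (v j) = μ • (v j : Complexification X) := fun j => mem_ker_iff.mp (v j).2
  choose u hu hfix using fun j =>
    PreadjointSystem.exists_fixed_ge_modulus hT hr hws hμ (hvT j)
  have hu0 : ∀ j, 0 ≤ u j := fun j => (modulus_nonneg _).trans (hu j)
  obtain ⟨K, σ, V, e, hinj, hσ, hF, hmem⟩ := PreadjointSystem.exists_complex_representation hT
    (Finset.sum_nonneg fun j (_ : j ∈ Finset.univ) => hu0 j)
    (by rw [map_sum]; exact Finset.sum_congr rfl fun j _ => hfix j)
  have hvV : ∀ j, (v j : Complexification X) ∈ V := fun j => hmem μ _ hμ (hvT j)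
    ((hu j).trans (Finset.single_le_sum (fun k _ => hu0 k) (Finset.mem_univ j)))
  have hli : LinearIndependent ℂ fun j => e ⟨v j, hvV j⟩ := by
    refine LinearIndependent.map' (v := fun j => (⟨v j, hvV j⟩ : V)) ?_ e
      (LinearMap.ker_eq_bot.mpr hinj)
    refine LinearIndependent.of_comp V.subtype ?_
    exact hv.map' (Submodule.subtype _) (Submodule.ker_subtype _)
  obtain ⟨p, A, hA⟩ := exists_dual_points hli
  -- The eigenvectors `g i` are biorthogonal to the evaluations at the points `p k`, and so are
  -- their phase powers, which are therefore linearly independent.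
  let g : Fin m → V := fun i => ∑ j, A i j • (⟨v j, hvV j⟩ : V)
  have hg : ∀ i k, e (g i) (p k) = if i = k then 1 else 0 := fun i k => by
    rw [← hA i k]
    simp only [g, map_sum, map_smul, Finset.sum_apply, Pi.smul_apply, smul_eq_mul]
  have hgT : ∀ i, T (g i) = μ • (g i : Complexification X) := fun i => by
    simp only [g, Submodule.coe_sum, Submodule.coe_smul, map_sum, map_smul, hvT, Finset.smul_sum]
    exact Finset.sum_congr rfl fun j _ => smul_comm _ _ _
  have hgσ : ∀ i q, e (g i) (σ q) = μ * e (g i) q := fun i q => by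
    obtain ⟨hz, h⟩ := hσ (g i)
    have e1 : (⟨T (g i), hz⟩ : V) = μ • g i := Subtype.ext (hgT i)
    rw [← h, e1, map_smul]
    rfl
  choose w hw using fun i => hF (phasePow n) (continuous_phasePow n) (g i)
  have hwT : ∀ i, T (w i) = μ ^ n • (w i : Complexification X) := fun i => by
    obtain ⟨hz, h⟩ := hσ (w i)
    have e1 : (⟨T (w i), hz⟩ : V) = μ ^ n • w i := hinj (funext fun q => by
      rw [h, hw, hgσ, phasePow_mul hμ, map_smul, Pi.smul_apply, hw, smul_eq_mul])
    exact congrArg Subtype.val e1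
  refine ⟨fun i => ⟨w i, mem_ker_iff.mpr (hwT i)⟩, ?_⟩
  refine LinearIndependent.of_comp (Submodule.subtype _) ?_
  have hwli : LinearIndependent ℂ w := by
    refine Fintype.linearIndependent_iff.mpr fun c hc k => ?_
    have h := congrFun (congrArg e hc) (p k)
    rw [map_sum, Finset.sum_apply, map_zero, Pi.zero_apply] at h
    rw [Finset.sum_eq_single k] at h
    · simpa [hw, hg, phasePow_one] using h
    · intro i _ hik
      simp [hw, hg, hik, phasePow_zero]
    · simp
  exact hwli.map' V.subtype V.ker_subtype

theorem one_le_kerDim_iff {T : Complexification X →L[ℂ] Complexification X} {μ : ℂ} :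
    1 ≤ kerDim μ T ↔ ∃ z : Complexification X, z ≠ 0 ∧ T z = μ • z := by
  rw [kerDim, Cardinal.one_le_toENat, Cardinal.one_le_iff_ne_zero, ne_eq, rank_zero_iff,
    not_subsingleton_iff_nontrivial, Submodule.nontrivial_iff_ne_bot, Submodule.ne_bot_iff]
  simp only [mem_ker_iff, and_comm]

end EigenspaceDimension

theorem mainTheorem2 {X : Type u} {Y : Type v}
    [NormedAddCommGroup X] [NormedSpace ℝ X] [CompleteSpace X] [Lattice X]
    [IsOrderedAddMonoid X] [IsOrderedModule ℝ X] [HasSolidNorm X]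
    [NormedAddCommGroup Y] [NormedSpace ℝ Y] [CompleteSpace Y] [Lattice Y]
    [IsOrderedAddMonoid Y] [IsOrderedModule ℝ Y] [HasSolidNorm Y]
    (T : Complexification X →L[ℂ] Complexification X)
    (hpos : IsPositiveOperator T)
    (hr : spectralRadius ℂ T = 1)
    (D : PredualBanachLattice X Y)
    (hpre : HasPreadjoint D T)
    (hws : IsWSBounded.{u, w} T) :
    (∀ (n : ℤ) (θ : ℝ),
      kerDim (Complex.exp (θ * Complex.I)) T ≤ kerDim (Complex.exp (n * θ * Complex.I)) T) ∧
    IsCyclicSet (peripheralPointSpectrum T) := by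
  have hdim : ∀ (n : ℤ) (θ : ℝ),
      kerDim (Complex.exp (θ * Complex.I)) T ≤ kerDim (Complex.exp (n * θ * Complex.I)) T := by
    intro n θ
    rw [mul_assoc, Complex.exp_int_mul]
    exact PreadjointSystem.kerDim_le_kerDim_zpow (D := D.system hpos hpre) hpos.apply_eq hr hws
      (Complex.norm_exp_ofReal_mul_I θ) n
  refine ⟨hdim, fun r θ hr0 hmem n => ?_⟩
  obtain ⟨hev, hnorm⟩ := hmem
  have hr1 : r = 1 := by
    rw [hr, ENNReal.coe_eq_one, ← NNReal.coe_eq_one, coe_nnnorm, norm_mul,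
      Complex.norm_exp_ofReal_mul_I, mul_one, Complex.norm_real, Real.norm_of_nonneg hr0] at hnorm
    exact hnorm
  subst hr1
  rw [Complex.ofReal_one, one_mul] at hev ⊢
  refine ⟨one_le_kerDim_iff.mp ((one_le_kerDim_iff.mpr hev).trans (hdim n θ)), ?_⟩
  have h : ‖Complex.exp (n * θ * Complex.I)‖ = 1 := by
    have := Complex.norm_exp_ofReal_mul_I (n * θ)
    push_cast at this
    exact this
  rw [hr, ENNReal.coe_eq_one, ← NNReal.coe_eq_one, coe_nnnorm, h]
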